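/- Let $\Bbbk$ be a field, let $\Gamma$ be an abelian group (written multiplicatively), and let $\widehat\Gamma=\operatorname{Hom}(\Gamma,\Bbbk^\times)$, with trivial character $\varepsilon$. Let $V$ be a Yetter–Drinfeld module over the group algebra $\Bbbk\Gamma$, with action $h\otimes v\mapsto h\cdot v$ and coaction $\delta\colon V\to\Bbbk\Gamma\otimes V$, that has a basis $x_1,\dots,x_n$ such that, for some $g_1,\dots,g_n\in\Gamma$ and $\chi_1,\dots,\chi_n\in\widehat\Gamma$, $$h\cdot x_j=\chi_j(h)\,x_j\quad(h\in\Gamma),\qquad \delta(x_j)=g_j\otimes x_j,\qquad 1\le j\le n .$$ Let $\mathfrak B(V)$ be the Nichols algebra of $V$, that is, the quotient of the tensor algebra $T(V)$, regarded as a braided Hopf algebra in the category of Yetter–Drinfeld modules over $\Bbbk\Gamma$ in which the elements of $V$ are primitive, by its largest Yetter–Drinfeld Hopf ideal generated by homogeneous elements of degree at least $2$. Let $\mathfrak B(V)\#\Bbbk\Gamma$ be its bosonization: the Hopf algebra with underlying vector space $\mathfrak B(V)\otimes\Bbbk\Gamma$ and, for $r,s\in\mathfrak B(V)$ and $\gamma,\gamma'\in\Gamma$,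 $$(r\#\gamma)(s\#\gamma')=r(\gamma\cdot s)\#\gamma\gamma',\qquad \Delta(r\#\gamma)=r^{(1)}\#(r^{(2)})_{(-1)}\gamma\otimes(r^{(2)})_{(0)}\#\gamma .$$ Suppose that $\chi_i\ne\varepsilon$ for all $i$, and that $(g_i,\chi_i)\ne(g_j,\chi_j)$ for all $i\ne j$. Then there is a bijection $\Phi\mapsto(\phi,\psi)$ from the set of Hopf algebra automorphisms of $\mathfrak B(V)\#\Bbbk\Gamma$ onto the set of pairs $(\phi,\psi)$, where $\psi$ is a group automorphism of $\Gamma$ and $\phi\colon V\to V$ is a linear isomorphism for which there are $\lambda_1,\dots,\lambda_n\in\Bbbk^\times$ and $\sigma\in\mathbb S_n$ with $$\phi(x_i)=\lambda_i x_{\sigma(i)},\qquad \psi(g_i)=g_{\sigma(i)},\qquad \chi_i=\chi_{\sigma(i)}\circ\psi,\qquad 1\le i\le n .$$ The bijection is such that $\Phi(v\#1)=\phi(v)\#1$ for all $v\in V$ and $\Phi(1\#\gamma)=1\#\psi(\gamma)$ for all $\gamma\in\Gamma$. -/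

import Mathlib

open scoped TensorProduct

/-- A (left-left) Yetter-Drinfeld module structure on the vector space `V` over the Hopf algebra
`H = kΓ`, for an abelian group `Γ`. An `H`-module is a representation of `Γ`. Since `Γ` is abelian
and its elements `γ` are group-like with `S γ = γ⁻¹`, the compatibility
`δ(h.v) = h₁ v₋₁ S(h₃) ⊗ h₂.v₀` says that `δ(γ.v) = v₋₁ ⊗ γ.v₀`. -/
structure YDModule (k Γ V : Type*) [Field k] [CommGroup Γ] [AddCommGroup V] [Module k V] where
  /-- the action of `Γ` -/
  act : Representation k Γ V
  /-- the coaction `δ : V → kΓ ⊗ V` -/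
  coact : V →ₗ[k] MonoidAlgebra k Γ ⊗[k] V
  coact_coassoc : ∀ v : V,
    TensorProduct.assoc k (MonoidAlgebra k Γ) (MonoidAlgebra k Γ) V
      ((Coalgebra.comul (R := k) (A := MonoidAlgebra k Γ)).rTensor V (coact v)) =
    coact.lTensor (MonoidAlgebra k Γ) (coact v)
  coact_counit : ∀ v : V,
    TensorProduct.lid k V
      ((Coalgebra.counit (R := k) (A := MonoidAlgebra k Γ)).rTensor V (coact v)) = v
  coact_act : ∀ (γ : Γ) (v : V),
    coact (act γ v) = (act γ).lTensor (MonoidAlgebra k Γ) (coact v)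

namespace YDModule

noncomputable section

variable {k Γ V : Type*} [Field k] [CommGroup Γ] [AddCommGroup V] [Module k V]

theorem span_homogeneous (M : YDModule k Γ V) :
    Submodule.span k {v : V | ∃ g : Γ, M.coact v = MonoidAlgebra.single g 1 ⊗ₜ[k] v} = ⊤ := by
  classical
  rw [eq_top_iff]
  rintro v -
  have key : ∀ z : MonoidAlgebra k Γ ⊗[k] V, ∃ f : Γ →₀ V,
      z = f.sum fun g w => MonoidAlgebra.single g (1 : k) ⊗ₜ[k] w := by
    intro z
    induction z using TensorProduct.induction_on with
    | zero => exact ⟨0, by simp⟩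
    | add x y hx hy =>
      obtain ⟨f, rfl⟩ := hx
      obtain ⟨f', rfl⟩ := hy
      refine ⟨f + f', ?_⟩
      rw [Finsupp.sum_add_index'] <;> simp [TensorProduct.tmul_add]
    | tmul a w =>
      induction a using MonoidAlgebra.induction_linear with
      | zero => exact ⟨0, by simp⟩
      | add x y hx hy =>
        obtain ⟨f, hf⟩ := hx
        obtain ⟨f', hf'⟩ := hy
        refine ⟨f + f', ?_⟩
        rw [TensorProduct.add_tmul, hf, hf', Finsupp.sum_add_index'] <;>
          simp [TensorProduct.tmul_add]
      | single g c =>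
        refine ⟨Finsupp.single g (c • w), ?_⟩
        rw [Finsupp.sum_single_index (by simp), ← TensorProduct.smul_tmul]
        simp
  obtain ⟨f, hf⟩ := key (M.coact v)
  have h1 := M.coact_coassoc v
  have h2 := M.coact_counit v
  rw [hf] at h1 h2
  simp only [Finsupp.sum, map_sum, LinearMap.rTensor_tmul, LinearMap.lTensor_tmul,
    MonoidAlgebra.comul_single, MonoidAlgebra.counit_single, CommSemiring.comul_apply,
    CommSemiring.counit_apply, TensorProduct.map_tmul, TensorProduct.assoc_tmul,
    TensorProduct.lid_tmul, one_smul, MonoidAlgebra.lsingle_apply] at h1 h2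
  rw [← h2]
  refine Submodule.sum_mem _ fun g hg => Submodule.subset_span ⟨g, ?_⟩
  let c : MonoidAlgebra k Γ →ₗ[k] k :=
    Finsupp.lapply g ∘ₗ (MonoidAlgebra.coeffLinearEquiv k).toLinearMap
  have hc : ∀ a : Γ, c (MonoidAlgebra.single a 1) = if a = g then 1 else 0 := by
    intro a
    simp [c, Finsupp.single_apply]
  have h3 := congrArg (fun z => TensorProduct.lid k _ (c.rTensor _ z)) h1
  simp only [map_sum, LinearMap.rTensor_tmul, hc, TensorProduct.lid_tmul, ite_smul, one_smul,
    zero_smul, Finset.sum_ite_eq', hg, if_true] at h3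
  exact h3.symm

/-- Linear maps that agree on the homogeneous vectors (those with `δ v = g ⊗ v`) are equal. -/
theorem hom_ext_homogeneous (M : YDModule k Γ V) {W : Type*} [AddCommGroup W] [Module k W]
    {f f' : V →ₗ[k] W}
    (h : ∀ (g : Γ) (v : V), M.coact v = MonoidAlgebra.single g 1 ⊗ₜ[k] v → f v = f' v) :
    f = f' :=
  LinearMap.ext_on M.span_homogeneous (by rintro v ⟨g, hv⟩; exact h g v hv)

/-! ### The tensor algebra as a braided bialgebra -/

/-- The action of `γ` on `T(V)` by algebra automorphisms, extending the action on `V`. -/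
def tAct (M : YDModule k Γ V) (γ : Γ) : TensorAlgebra k V →ₐ[k] TensorAlgebra k V :=
  TensorAlgebra.lift k (TensorAlgebra.ι k ∘ₗ M.act γ)

@[simp]
theorem tAct_ι (M : YDModule k Γ V) (γ : Γ) (v : V) :
    M.tAct γ (TensorAlgebra.ι k v) = TensorAlgebra.ι k (M.act γ v) := by
  simp [tAct]

theorem tAct_one (M : YDModule k Γ V) : M.tAct 1 = AlgHom.id k _ := by
  ext v; simp

theorem tAct_mul (M : YDModule k Γ V) (γ γ' : Γ) :
    M.tAct (γ * γ') = (M.tAct γ).comp (M.tAct γ') := by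
  ext v; simp

/-- The action of `Γ` on `T(V)` as a representation. -/
def tRep (M : YDModule k Γ V) : Representation k Γ (TensorAlgebra k V) where
  toFun γ := (M.tAct γ).toLinearMap
  map_one' := by rw [tAct_one]; rfl
  map_mul' γ γ' := by rw [tAct_mul]; rfl

/-- The coaction `δ : T(V) → kΓ ⊗ T(V)`: the algebra map extending the coaction of `V`. -/
def tCoact (M : YDModule k Γ V) :
    TensorAlgebra k V →ₐ[k] MonoidAlgebra k Γ ⊗[k] TensorAlgebra k V :=
  TensorAlgebra.lift k ((TensorAlgebra.ι k).lTensor (MonoidAlgebra k Γ) ∘ₗ M.coact)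

@[simp]
theorem tCoact_ι (M : YDModule k Γ V) (v : V) :
    M.tCoact (TensorAlgebra.ι k v) =
      (TensorAlgebra.ι k).lTensor (MonoidAlgebra k Γ) (M.coact v) := by
  simp [tCoact]

/-- The algebra map `kΓ ⊗ T(V) → End (T(V) ⊗ T(V))`, `h ⊗ y ↦ (u ⊗ v ↦ h.u ⊗ y v)`. -/
def tActMul (M : YDModule k Γ V) :
    MonoidAlgebra k Γ ⊗[k] TensorAlgebra k V →ₐ[k]
      Module.End k (TensorAlgebra k V ⊗[k] TensorAlgebra k V) :=
  (Module.endTensorEndAlgHom (R := k) (S := k) (A := k)).comp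
    (Algebra.TensorProduct.map M.tRep.asAlgebraHom (Algebra.lmul k (TensorAlgebra k V)))

theorem tActMul_single (M : YDModule k Γ V) (γ : Γ) (y u v : TensorAlgebra k V) :
    M.tActMul (MonoidAlgebra.single γ 1 ⊗ₜ y) (u ⊗ₜ v) = M.tAct γ u ⊗ₜ (y * v) := by
  simp only [tActMul, AlgHom.comp_apply, Algebra.TensorProduct.map_tmul,
    Representation.asAlgebraHom_single_one, Module.endTensorEndAlgHom_apply]
  rfl

/-- The multiplication of the braided tensor product `T(V) ⊗ T(V)`, twisted by the braiding
`y ⊗ u ↦ y₋₁.u ⊗ y₀`; that is, `(x ⊗ y) (u ⊗ v) = x (y₋₁.u) ⊗ y₀ v`. -/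
def braidedMul (M : YDModule k Γ V) :
    TensorAlgebra k V ⊗[k] TensorAlgebra k V →ₗ[k]
      Module.End k (TensorAlgebra k V ⊗[k] TensorAlgebra k V) :=
  TensorProduct.lift
    ((LinearMap.mul k (Module.End k (TensorAlgebra k V ⊗[k] TensorAlgebra k V))).compl₁₂
      (LinearMap.rTensorHom (TensorAlgebra k V) ∘ₗ LinearMap.mul k (TensorAlgebra k V))
      (M.tActMul.toLinearMap ∘ₗ M.tCoact.toLinearMap))

theorem braidedMul_tmul (M : YDModule k Γ V) (x y : TensorAlgebra k V) :
    M.braidedMul (x ⊗ₜ y) =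
      (LinearMap.mulLeft k x).rTensor (TensorAlgebra k V) * M.tActMul (M.tCoact y) :=
  rfl

/-- For `v ∈ V`, the left multiplication by `v ⊗ 1 + 1 ⊗ v` in the braided tensor product
`T(V) ⊗ T(V)`; extended to an algebra map `T(V) → End (T(V) ⊗ T(V))`. -/
def tComulEnd (M : YDModule k Γ V) :
    TensorAlgebra k V →ₐ[k] Module.End k (TensorAlgebra k V ⊗[k] TensorAlgebra k V) :=
  TensorAlgebra.lift k
    (M.braidedMul ∘ₗ
      ((TensorProduct.mk k (TensorAlgebra k V) (TensorAlgebra k V)).flip 1 +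
        TensorProduct.mk k (TensorAlgebra k V) (TensorAlgebra k V) 1) ∘ₗ TensorAlgebra.ι k)

theorem tComulEnd_ι (M : YDModule k Γ V) (v : V) :
    M.tComulEnd (TensorAlgebra.ι k v) =
      M.braidedMul (TensorAlgebra.ι k v ⊗ₜ 1 + 1 ⊗ₜ TensorAlgebra.ι k v) := by
  simp [tComulEnd]

/-- The comultiplication `Δ : T(V) → T(V) ⊗ T(V)`: the algebra map into the braided tensor product
with `Δ v = v ⊗ 1 + 1 ⊗ v` for `v ∈ V` (see `tComul_one`, `tComul_ι` and `tComul_mul`). -/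
def tComul (M : YDModule k Γ V) :
    TensorAlgebra k V →ₗ[k] TensorAlgebra k V ⊗[k] TensorAlgebra k V :=
  LinearMap.applyₗ (1 ⊗ₜ 1) ∘ₗ M.tComulEnd.toLinearMap

theorem tComul_one (M : YDModule k Γ V) : M.tComul 1 = 1 ⊗ₜ 1 := by
  simp [tComul]

theorem tComul_ι_mul (M : YDModule k Γ V) (v : V) (t : TensorAlgebra k V) :
    M.tComul (TensorAlgebra.ι k v * t) =
      M.braidedMul (TensorAlgebra.ι k v ⊗ₜ 1 + 1 ⊗ₜ TensorAlgebra.ι k v) (M.tComul t) := by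
  rw [← tComulEnd_ι]
  simp [tComul]

theorem braidedMul_ι (M : YDModule k Γ V) {g : Γ} {v : V}
    (hv : M.coact v = MonoidAlgebra.single g 1 ⊗ₜ v) (a b : TensorAlgebra k V) :
    M.braidedMul (TensorAlgebra.ι k v ⊗ₜ 1 + 1 ⊗ₜ TensorAlgebra.ι k v) (a ⊗ₜ b) =
      (TensorAlgebra.ι k v * a) ⊗ₜ b + M.tAct g a ⊗ₜ (TensorAlgebra.ι k v * b) := by
  simp [braidedMul_tmul, hv, tActMul_single]

theorem tComul_ι (M : YDModule k Γ V) (v : V) :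
    M.tComul (TensorAlgebra.ι k v) = TensorAlgebra.ι k v ⊗ₜ 1 + 1 ⊗ₜ TensorAlgebra.ι k v := by
  have : M.tComul ∘ₗ TensorAlgebra.ι k =
      ((TensorProduct.mk k (TensorAlgebra k V) (TensorAlgebra k V)).flip 1 +
        TensorProduct.mk k (TensorAlgebra k V) (TensorAlgebra k V) 1) ∘ₗ TensorAlgebra.ι k := by
    refine M.hom_ext_homogeneous fun g v hv => ?_
    have := M.tComul_ι_mul v 1
    rw [tComul_one, braidedMul_ι M hv] at this
    simpa using this
  simpa using LinearMap.congr_fun this v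

theorem end_ext {f f' : Module.End k (TensorAlgebra k V ⊗[k] TensorAlgebra k V)}
    (h : ∀ a b, f (a ⊗ₜ b) = f' (a ⊗ₜ b)) : f = f' :=
  TensorProduct.ext' h

theorem braidedMul_assoc_ι (M : YDModule k Γ V) (v : V)
    (X : TensorAlgebra k V ⊗[k] TensorAlgebra k V) :
    M.braidedMul (M.tComulEnd (TensorAlgebra.ι k v) X) =
      M.tComulEnd (TensorAlgebra.ι k v) * M.braidedMul X := by
  have : M.braidedMul ∘ₗ LinearMap.applyₗ X ∘ₗ M.tComulEnd.toLinearMap ∘ₗ TensorAlgebra.ι k =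
      LinearMap.mulRight k (M.braidedMul X) ∘ₗ M.tComulEnd.toLinearMap ∘ₗ
        TensorAlgebra.ι k := by
    refine M.hom_ext_homogeneous
      (W := Module.End k (TensorAlgebra k V ⊗[k] TensorAlgebra k V))
      fun g v hv => ?_
    simp only [LinearMap.comp_apply, LinearMap.applyₗ_apply_apply, LinearMap.mulRight_apply,
      AlgHom.toLinearMap_apply]
    induction X using TensorProduct.induction_on with
    | zero => simp
    | add X Y hX hY => rw [map_add, map_add, hX, hY, map_add, mul_add]
    | tmul a b =>
      rw [tComulEnd_ι, braidedMul_ι M hv, map_add, braidedMul_tmul, braidedMul_tmul,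
        braidedMul_tmul, map_mul M.tCoact, map_mul M.tActMul, tCoact_ι, hv,
        LinearMap.lTensor_tmul, ← mul_assoc, ← mul_assoc, ← add_mul]
      congr 1
      refine end_ext fun c d => ?_
      have := braidedMul_ι M hv (a * c) d
      simp only [LinearMap.add_apply, Module.End.mul_apply, LinearMap.rTensor_tmul,
        LinearMap.mulLeft_apply, tActMul_single, this, map_mul, mul_assoc]
  exact LinearMap.congr_fun this v

theorem mem_of_ι_mul_mem (C : Submodule k (TensorAlgebra k V)) (h1 : 1 ∈ C)
    (hι : ∀ v, ∀ t ∈ C, TensorAlgebra.ι k v * t ∈ C) (t : TensorAlgebra k V) : t ∈ C := by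
  suffices h : ∀ s ∈ C, t * s ∈ C by simpa using h 1 h1
  induction t using TensorAlgebra.induction with
  | algebraMap r => intro s hs; rw [← Algebra.smul_def]; exact C.smul_mem r hs
  | ι v => exact hι v
  | mul a b ha hb => intro s hs; rw [mul_assoc]; exact ha _ (hb _ hs)
  | add a b ha hb => intro s hs; rw [add_mul]; exact C.add_mem (ha _ hs) (hb _ hs)

/-- Linear maps on `T(V)` are equal if they agree on `1` and agreement at `t` implies agreement at
`v t` for `v ∈ V`. -/
theorem tensor_hom_ext {W : Type*} [AddCommGroup W] [Module k W]
    {f f' : TensorAlgebra k V →ₗ[k] W} (h1 : f 1 = f' 1)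
    (hι : ∀ v t, f t = f' t → f (TensorAlgebra.ι k v * t) = f' (TensorAlgebra.ι k v * t)) :
    f = f' :=
  LinearMap.ext fun t => mem_of_ι_mul_mem (LinearMap.eqLocus f f') h1 hι t

/-- `Δ` is multiplicative for the braided tensor product. -/
theorem tComul_mul (M : YDModule k Γ V) (s t : TensorAlgebra k V) :
    M.tComul (s * t) = M.braidedMul (M.tComul s) (M.tComul t) := by
  have key : M.braidedMul ∘ₗ M.tComul = M.tComulEnd.toLinearMap := by
    refine tensor_hom_ext
      (W := Module.End k (TensorAlgebra k V ⊗[k] TensorAlgebra k V))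
      ?_ fun v s hs => ?_
    · refine end_ext fun c d => ?_
      simp [tComul_one, braidedMul_tmul]
    · have h := M.braidedMul_assoc_ι v (M.tComul s)
      rw [LinearMap.comp_apply] at hs
      rw [LinearMap.comp_apply, tComul_ι_mul, ← tComulEnd_ι, h, hs]
      simp
  have h := LinearMap.congr_fun key s
  rw [LinearMap.comp_apply] at h
  rw [h]
  simp [tComul]

/-! ### The Nichols algebra -/

/-- The homogeneous components `V^{⊗ n}` of `T(V)`. -/
abbrev tGrading (_M : YDModule k Γ V) (n : ℕ) : Submodule k (TensorAlgebra k V) :=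
  LinearMap.range (TensorAlgebra.ι k : V →ₗ[k] TensorAlgebra k V) ^ n

/-- The two-sided ideals of `T(V)` that are generated by homogeneous elements of degree at least
two (that is, which are homogeneous and vanish in the degrees `0` and `1`), are Yetter-Drinfeld
submodules, and are coideals: `Δ(I) ⊆ I ⊗ T(V) + T(V) ⊗ I`. -/
structure IsHopfIdeal (M : YDModule k Γ V) (I : Ideal (TensorAlgebra k V)) : Prop where
  isTwoSided : I.IsTwoSided
  isHomogeneous : I.IsHomogeneous M.tGrading
  proj_eq_zero : ∀ t ∈ I, ∀ n < 2, GradedRing.proj M.tGrading n t = 0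
  act_mem : ∀ γ : Γ, ∀ t ∈ I, M.tAct γ t ∈ I
  coact_mem : ∀ t ∈ I, M.tCoact t ∈
    LinearMap.range ((I.restrictScalars k).subtype.lTensor (MonoidAlgebra k Γ))
  comul_mem : ∀ t ∈ I, M.tComul t ∈
    LinearMap.range ((I.restrictScalars k).subtype.rTensor (TensorAlgebra k V)) ⊔
      LinearMap.range ((I.restrictScalars k).subtype.lTensor (TensorAlgebra k V))

/-- The sum of all the ideals as in `IsHopfIdeal`: the defining ideal of the Nichols algebra. -/
def nicholsIdeal (M : YDModule k Γ V) : Ideal (TensorAlgebra k V) :=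
  sSup {I | M.IsHopfIdeal I}

theorem nicholsIdeal_induction (M : YDModule k Γ V) (C : Submodule k (TensorAlgebra k V))
    (h : ∀ I, M.IsHopfIdeal I → ∀ t ∈ I, t ∈ C) (t : TensorAlgebra k V)
    (ht : t ∈ M.nicholsIdeal) : t ∈ C := by
  rw [nicholsIdeal, sSup_eq_iSup'] at ht
  induction ht using Submodule.iSup_induction' with
  | mem I t ht => exact h I.1 I.2 t ht
  | zero => exact C.zero_mem
  | add x y _ _ hx hy => exact C.add_mem hx hy

theorem IsHopfIdeal.le {M : YDModule k Γ V} {I : Ideal (TensorAlgebra k V)}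
    (h : M.IsHopfIdeal I) : I ≤ M.nicholsIdeal :=
  le_sSup h

theorem lTensor_range_mono {I J : Submodule k (TensorAlgebra k V)} (h : I ≤ J)
    (P : Type*) [AddCommGroup P] [Module k P] :
    LinearMap.range (I.subtype.lTensor P) ≤ LinearMap.range (J.subtype.lTensor P) := by
  rw [← Submodule.subtype_comp_inclusion I J h, LinearMap.lTensor_comp]
  exact LinearMap.range_comp_le_range _ _

theorem rTensor_range_mono {I J : Submodule k (TensorAlgebra k V)} (h : I ≤ J)
    (P : Type*) [AddCommGroup P] [Module k P] :
    LinearMap.range (I.subtype.rTensor P) ≤ LinearMap.range (J.subtype.rTensor P) := by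
  rw [← Submodule.subtype_comp_inclusion I J h, LinearMap.rTensor_comp]
  exact LinearMap.range_comp_le_range _ _

theorem isHopfIdeal_nicholsIdeal (M : YDModule k Γ V) : M.IsHopfIdeal M.nicholsIdeal where
  isTwoSided := ⟨fun {a} b ha => M.nicholsIdeal_induction
    ((M.nicholsIdeal.restrictScalars k).comap (LinearMap.mulRight k b))
    (fun I hI t ht => hI.le (hI.isTwoSided.mul_mem_of_left b ht)) a ha⟩
  isHomogeneous := by
    rw [nicholsIdeal, sSup_eq_iSup]
    exact Ideal.IsHomogeneous.iSup₂ fun I hI => hI.isHomogeneous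
  proj_eq_zero t ht n hn := M.nicholsIdeal_induction
    (LinearMap.ker (GradedAlgebra.proj M.tGrading n))
    (fun I hI t ht => hI.proj_eq_zero t ht n hn) t ht
  act_mem γ := M.nicholsIdeal_induction
    ((M.nicholsIdeal.restrictScalars k).comap (M.tAct γ).toLinearMap)
    (fun I hI t ht => hI.le (hI.act_mem γ t ht))
  coact_mem := M.nicholsIdeal_induction
    ((LinearMap.range ((M.nicholsIdeal.restrictScalars k).subtype.lTensor
      (MonoidAlgebra k Γ))).comap M.tCoact.toLinearMap)
    (fun I hI t ht => lTensor_range_mono (I := I.restrictScalars k) hI.le _ (hI.coact_mem t ht))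
  comul_mem := M.nicholsIdeal_induction
    ((LinearMap.range ((M.nicholsIdeal.restrictScalars k).subtype.rTensor (TensorAlgebra k V)) ⊔
      LinearMap.range ((M.nicholsIdeal.restrictScalars k).subtype.lTensor
        (TensorAlgebra k V))).comap M.tComul)
    (fun I hI t ht => sup_le_sup (rTensor_range_mono (I := I.restrictScalars k) hI.le _)
      (lTensor_range_mono (I := I.restrictScalars k) hI.le _) (hI.comul_mem t ht))

instance (M : YDModule k Γ V) : M.nicholsIdeal.IsTwoSided :=
  M.isHopfIdeal_nicholsIdeal.isTwoSided

theorem algebraMapInv_eq_proj (M : YDModule k Γ V) :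
    Algebra.linearMap k (TensorAlgebra k V) ∘ₗ TensorAlgebra.algebraMapInv.toLinearMap =
      GradedAlgebra.proj M.tGrading 0 := by
  refine tensor_hom_ext ?_ fun v t _ => ?_
  · have : GradedAlgebra.proj M.tGrading 0 1 = 1 :=
      DirectSum.decompose_of_mem_same M.tGrading (SetLike.GradedOne.one_mem)
    rw [this]; simp
  · have h1 : TensorAlgebra.ι k v ∈ M.tGrading 1 := by
      simp [tGrading]
    have : GradedAlgebra.proj M.tGrading 0 (TensorAlgebra.ι k v * t) = 0 :=
      DirectSum.coe_decompose_mul_of_left_mem_of_not_le M.tGrading h1 (by norm_num)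
    rw [this]
    simp [TensorAlgebra.algebraMapInv]

/-- The Nichols algebra `𝔅(V)`: the quotient of `T(V)` by its largest Hopf ideal generated by
homogeneous elements of degree at least two. -/
def NicholsAlgebra (M : YDModule k Γ V) : Type _ :=
  TensorAlgebra k V ⧸ M.nicholsIdeal

namespace NicholsAlgebra

variable (M : YDModule k Γ V)

instance : Ring M.NicholsAlgebra :=
  inferInstanceAs (Ring (TensorAlgebra k V ⧸ M.nicholsIdeal))

instance : Algebra k M.NicholsAlgebra :=
  inferInstanceAs (Algebra k (TensorAlgebra k V ⧸ M.nicholsIdeal))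

/-- The projection `T(V) → 𝔅(V)`. -/
def mk : TensorAlgebra k V →ₐ[k] M.NicholsAlgebra :=
  Ideal.Quotient.mkₐ k M.nicholsIdeal

theorem mk_surjective : Function.Surjective (mk M) :=
  Ideal.Quotient.mkₐ_surjective k M.nicholsIdeal

theorem mk_eq_zero (t : TensorAlgebra k V) : mk M t = 0 ↔ t ∈ M.nicholsIdeal :=
  Ideal.Quotient.eq_zero_iff_mem

/-- The inclusion `V → 𝔅(V)`. -/
def ι : V →ₗ[k] M.NicholsAlgebra :=
  (mk M).toLinearMap ∘ₗ TensorAlgebra.ι k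

/-- Linear maps on `T(V)` that vanish on the defining ideal descend to `𝔅(V)`. -/
def liftLinear {W : Type*} [AddCommGroup W] [Module k W] (f : TensorAlgebra k V →ₗ[k] W)
    (hf : ∀ t ∈ M.nicholsIdeal, f t = 0) : M.NicholsAlgebra →ₗ[k] W :=
  (M.nicholsIdeal.restrictScalars k).liftQ f hf

@[simp]
theorem liftLinear_mk {W : Type*} [AddCommGroup W] [Module k W] (f : TensorAlgebra k V →ₗ[k] W)
    (hf : ∀ t ∈ M.nicholsIdeal, f t = 0) (t : TensorAlgebra k V) :
    liftLinear M f hf (mk M t) = f t :=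
  rfl

/-- Algebra maps on `T(V)` that vanish on the defining ideal descend to `𝔅(V)`. -/
def lift {B : Type*} [Ring B] [Algebra k B] (f : TensorAlgebra k V →ₐ[k] B)
    (hf : ∀ t ∈ M.nicholsIdeal, f t = 0) : M.NicholsAlgebra →ₐ[k] B :=
  Ideal.Quotient.liftₐ M.nicholsIdeal f hf

@[simp]
theorem lift_mk {B : Type*} [Ring B] [Algebra k B] (f : TensorAlgebra k V →ₐ[k] B)
    (hf : ∀ t ∈ M.nicholsIdeal, f t = 0) (t : TensorAlgebra k V) :
    lift M f hf (mk M t) = f t :=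
  rfl

variable {M} in
theorem algHom_ext {B : Type*} [Ring B] [Algebra k B] {f f' : M.NicholsAlgebra →ₐ[k] B}
    (h : ∀ v, f (ι M v) = f' (ι M v)) : f = f' := by
  have : f.comp (mk M) = f'.comp (mk M) := by
    ext v; exact h v
  ext r
  obtain ⟨t, rfl⟩ := mk_surjective M r
  exact DFunLike.congr_fun this t

/-- The action of `γ ∈ Γ` on `𝔅(V)`. -/
def act (γ : Γ) : M.NicholsAlgebra →ₐ[k] M.NicholsAlgebra :=
  lift M ((mk M).comp (M.tAct γ)) fun t ht =>
    (mk_eq_zero M _).2 (M.isHopfIdeal_nicholsIdeal.act_mem γ t ht)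

@[simp]
theorem act_mk (γ : Γ) (t : TensorAlgebra k V) : act M γ (mk M t) = mk M (M.tAct γ t) :=
  rfl

/-- `Γ` acts on `𝔅(V)` by algebra automorphisms. -/
instance : MulSemiringAction Γ M.NicholsAlgebra where
  smul γ r := act M γ r
  one_smul r := by
    obtain ⟨t, rfl⟩ := mk_surjective M r
    change act M 1 (mk M t) = mk M t
    rw [act_mk, tAct_one]; rfl
  mul_smul γ γ' r := by
    obtain ⟨t, rfl⟩ := mk_surjective M r
    change act M _ (mk M t) = act M _ (act M _ (mk M t))
    rw [act_mk, act_mk, act_mk, tAct_mul]; rfl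
  smul_zero γ := map_zero (act M γ)
  smul_add γ := map_add (act M γ)
  smul_one γ := map_one (act M γ)
  smul_mul γ := map_mul (act M γ)

theorem smul_mk (γ : Γ) (t : TensorAlgebra k V) : γ • mk M t = mk M (M.tAct γ t) :=
  rfl

theorem smul_ι (γ : Γ) (v : V) : γ • ι M v = ι M (M.act γ v) := by
  simp [ι, smul_mk]

instance : SMulCommClass Γ k M.NicholsAlgebra where
  smul_comm γ c r := map_smul (act M γ) c r

theorem map_lTensor_subtype {P W : Type*} [AddCommGroup P] [Module k P] [AddCommGroup W]
    [Module k W] (f : P →ₗ[k] W) (z : P ⊗[k] M.nicholsIdeal.restrictScalars k) :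
    TensorProduct.map f (mk M).toLinearMap
      ((M.nicholsIdeal.restrictScalars k).subtype.lTensor P z) = 0 := by
  rw [LinearMap.lTensor, ← LinearMap.comp_apply, ← TensorProduct.map_comp]
  have : (mk M).toLinearMap ∘ₗ (M.nicholsIdeal.restrictScalars k).subtype = 0 :=
    LinearMap.ext fun t => (mk_eq_zero M _).2 t.2
  rw [this, TensorProduct.map_zero_right, LinearMap.zero_apply]

theorem map_rTensor_subtype {P W : Type*} [AddCommGroup P] [Module k P] [AddCommGroup W]
    [Module k W] (f : P →ₗ[k] W) (z : M.nicholsIdeal.restrictScalars k ⊗[k] P) :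
    TensorProduct.map (mk M).toLinearMap f
      ((M.nicholsIdeal.restrictScalars k).subtype.rTensor P z) = 0 := by
  rw [LinearMap.rTensor, ← LinearMap.comp_apply, ← TensorProduct.map_comp]
  have : (mk M).toLinearMap ∘ₗ (M.nicholsIdeal.restrictScalars k).subtype = 0 :=
    LinearMap.ext fun t => (mk_eq_zero M _).2 t.2
  rw [this, TensorProduct.map_zero_left, LinearMap.zero_apply]

/-- The coaction `δ : 𝔅(V) → kΓ ⊗ 𝔅(V)`. -/
def coact : M.NicholsAlgebra →ₐ[k] MonoidAlgebra k Γ ⊗[k] M.NicholsAlgebra :=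
  lift M ((Algebra.TensorProduct.map (AlgHom.id k _) (mk M)).comp M.tCoact) fun t ht => by
    obtain ⟨z, hz⟩ := M.isHopfIdeal_nicholsIdeal.coact_mem t ht
    rw [AlgHom.comp_apply, ← hz]
    exact map_lTensor_subtype M (AlgHom.id k (MonoidAlgebra k Γ)).toLinearMap z

theorem coact_mk (t : TensorAlgebra k V) :
    coact M (mk M t) = Algebra.TensorProduct.map (AlgHom.id k _) (mk M) (M.tCoact t) :=
  rfl

/-- The comultiplication `Δ : 𝔅(V) → 𝔅(V) ⊗ 𝔅(V)`. -/
def comul : M.NicholsAlgebra →ₗ[k] M.NicholsAlgebra ⊗[k] M.NicholsAlgebra :=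
  liftLinear M (TensorProduct.map (mk M).toLinearMap (mk M).toLinearMap ∘ₗ M.tComul) fun t ht => by
    obtain ⟨x, ⟨x', rfl⟩, y, ⟨y', rfl⟩, hxy⟩ :=
      Submodule.mem_sup.1 (M.isHopfIdeal_nicholsIdeal.comul_mem t ht)
    rw [LinearMap.comp_apply, ← hxy, map_add, map_rTensor_subtype, map_lTensor_subtype, add_zero]

theorem comul_mk (t : TensorAlgebra k V) :
    comul M (mk M t) =
      TensorProduct.map (mk M).toLinearMap (mk M).toLinearMap (M.tComul t) :=
  rfl

/-- The counit `ε : 𝔅(V) → k`, with `ε(v) = 0` for `v ∈ V`. -/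
def counit : M.NicholsAlgebra →ₐ[k] k :=
  lift M TensorAlgebra.algebraMapInv fun t ht => by
    have h := LinearMap.congr_fun M.algebraMapInv_eq_proj t
    have h0 : GradedAlgebra.proj M.tGrading 0 t = 0 :=
      M.isHopfIdeal_nicholsIdeal.proj_eq_zero t ht 0 (by norm_num)
    rw [h0] at h
    exact (TensorAlgebra.algebraMap_eq_zero_iff V _).1 h

theorem counit_ι (v : V) : counit M (ι M v) = 0 := by
  change TensorAlgebra.algebraMapInv (TensorAlgebra.ι k v) = 0
  simp [TensorAlgebra.algebraMapInv]

end NicholsAlgebra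

/-! ### The bosonization -/

/-- The bosonization `𝔅(V) # kΓ`. Its elements are the linear combinations of the elements
`r # γ`, written `SkewMonoidAlgebra.single γ r`, with `r ∈ 𝔅(V)` and `γ ∈ Γ`; the multiplication is
`(r # γ) (s # γ') = r (γ.s) # γ γ'`. -/
abbrev Bosonization (M : YDModule k Γ V) : Type _ :=
  SkewMonoidAlgebra M.NicholsAlgebra Γ

namespace Bosonization

variable (M : YDModule k Γ V)

theorem single_mul_single (γ γ' : Γ) (r s : M.NicholsAlgebra) :
    (SkewMonoidAlgebra.single γ r * SkewMonoidAlgebra.single γ' s : M.Bosonization) =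
      SkewMonoidAlgebra.single (γ * γ') (r * γ • s) :=
  SkewMonoidAlgebra.single_mul_single

/-- The algebra map `𝔅(V) → 𝔅(V) # kΓ`, `r ↦ r # 1`. -/
def ofNichols : M.NicholsAlgebra →ₐ[k] M.Bosonization where
  toFun r := SkewMonoidAlgebra.single 1 r
  map_one' := rfl
  map_mul' r s := by simp
  map_zero' := by simp
  map_add' := by simp [SkewMonoidAlgebra.single_add]
  commutes' c := rfl

theorem ofNichols_apply (r : M.NicholsAlgebra) :
    ofNichols M r = SkewMonoidAlgebra.single 1 r :=
  rfl

/-- The group homomorphism from `Γ` to `𝔅(V) # kΓ`, `γ ↦ 1 # γ`. -/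
def ofGroup : Γ →* M.Bosonization where
  toFun γ := SkewMonoidAlgebra.single γ 1
  map_one' := rfl
  map_mul' γ γ' := by simp

theorem ofGroup_apply (γ : Γ) : ofGroup M γ = SkewMonoidAlgebra.single γ 1 :=
  rfl

theorem ofNichols_mul_ofGroup (r : M.NicholsAlgebra) (γ : Γ) :
    ofNichols M r * ofGroup M γ = SkewMonoidAlgebra.single γ r := by
  simp [ofNichols_apply, ofGroup_apply]

theorem ofGroup_mul_ofNichols (r : M.NicholsAlgebra) (γ : Γ) :
    ofGroup M γ * ofNichols M r = ofNichols M (γ • r) * ofGroup M γ := by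
  simp [ofNichols_apply, ofGroup_apply]

/-- The algebra map `kΓ → 𝔅(V) # kΓ`, `h ↦ 1 # h`. -/
def ofGroupAlgebra : MonoidAlgebra k Γ →ₐ[k] M.Bosonization :=
  MonoidAlgebra.lift k M.Bosonization Γ (ofGroup M)

theorem ofGroupAlgebra_single (γ : Γ) :
    ofGroupAlgebra M (MonoidAlgebra.single γ 1) = ofGroup M γ := by
  simp [ofGroupAlgebra]

/-- The linear map `𝔅(V) ⊗ kΓ → 𝔅(V) # kΓ`, `r ⊗ h ↦ r # h`. -/
def smash : M.NicholsAlgebra ⊗[k] MonoidAlgebra k Γ →ₗ[k] M.Bosonization :=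
  LinearMap.mul' k M.Bosonization ∘ₗ
    TensorProduct.map (ofNichols M).toLinearMap (ofGroupAlgebra M).toLinearMap

theorem smash_tmul_single (r : M.NicholsAlgebra) (γ : Γ) :
    smash M (r ⊗ₜ MonoidAlgebra.single γ 1) = SkewMonoidAlgebra.single γ r := by
  simp [smash, ofGroupAlgebra_single, ofNichols_mul_ofGroup]

/-- For `γ ∈ Γ`, the linear map `𝔅(V) ⊗ 𝔅(V) → (𝔅(V) # kΓ) ⊗ (𝔅(V) # kΓ)`,
`r ⊗ s ↦ (r # s₋₁ γ) ⊗ (s₀ # γ)`. -/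
def comulAux (γ : Γ) :
    M.NicholsAlgebra ⊗[k] M.NicholsAlgebra →ₗ[k] M.Bosonization ⊗[k] M.Bosonization :=
  TensorProduct.map
      (smash M ∘ₗ (LinearMap.mulRight k (MonoidAlgebra.single γ (1 : k))).lTensor
        M.NicholsAlgebra)
      (LinearMap.mulRight k (ofGroup M γ) ∘ₗ (ofNichols M).toLinearMap) ∘ₗ
    (TensorProduct.assoc k M.NicholsAlgebra (MonoidAlgebra k Γ)
      M.NicholsAlgebra).symm.toLinearMap ∘ₗ
    (NicholsAlgebra.coact M).toLinearMap.lTensor M.NicholsAlgebra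

/-- The comultiplication of the bosonization:
`Δ(r # γ) = (r₁ # (r₂)₋₁ γ) ⊗ ((r₂)₀ # γ)` for `γ ∈ Γ`. -/
def comulLinear : M.Bosonization →ₗ[k] M.Bosonization ⊗[k] M.Bosonization :=
  Finsupp.lsum k (fun γ => comulAux M γ ∘ₗ NicholsAlgebra.comul M) ∘ₗ
    (SkewMonoidAlgebra.coeffLinearEquiv (S := k)).toLinearMap

theorem comulLinear_single (γ : Γ) (r : M.NicholsAlgebra) :
    comulLinear M (SkewMonoidAlgebra.single γ r) = comulAux M γ (NicholsAlgebra.comul M r) := by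
  have : SkewMonoidAlgebra.coeffLinearEquiv (S := k) (SkewMonoidAlgebra.single γ r) =
      Finsupp.single γ r := rfl
  rw [comulLinear, LinearMap.comp_apply, LinearEquiv.coe_coe, this]
  simp

/-- The counit of the bosonization: `ε(r # γ) = ε(r)`. -/
def counitHom : M.Bosonization →ₐ[k] k :=
  SkewMonoidAlgebra.liftNCAlgHom (NicholsAlgebra.counit M) 1 fun {r γ} => by
    have : (NicholsAlgebra.counit M).comp (NicholsAlgebra.act M γ) = NicholsAlgebra.counit M := by
      refine NicholsAlgebra.algHom_ext fun v => ?_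
      have h : NicholsAlgebra.act M γ (NicholsAlgebra.ι M v) = NicholsAlgebra.ι M (M.act γ v) :=
        NicholsAlgebra.smul_ι M γ v
      rw [AlgHom.comp_apply, h, NicholsAlgebra.counit_ι, NicholsAlgebra.counit_ι]
    have h : NicholsAlgebra.counit M (γ • r) = NicholsAlgebra.counit M r :=
      DFunLike.congr_fun this r
    simpa using h

theorem counitHom_single (γ : Γ) (r : M.NicholsAlgebra) :
    counitHom M (SkewMonoidAlgebra.single γ r) = NicholsAlgebra.counit M r := by
  simp [counitHom, SkewMonoidAlgebra.liftNCAlgHom, SkewMonoidAlgebra.liftNCRingHom]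

/-- The algebra map `kΓ ⊗ 𝔅(V) → (𝔅(V) # kΓ) ⊗ (𝔅(V) # kΓ)`, `h ⊗ s ↦ (1 # h) ⊗ (s # 1)`. -/
def incl : MonoidAlgebra k Γ ⊗[k] M.NicholsAlgebra →ₐ[k] M.Bosonization ⊗[k] M.Bosonization :=
  Algebra.TensorProduct.map (ofGroupAlgebra M) (ofNichols M)

theorem comulAux_tmul (γ : Γ) (a b : M.NicholsAlgebra) :
    comulAux M γ (a ⊗ₜ b) =
      (ofNichols M a ⊗ₜ 1) * incl M (NicholsAlgebra.coact M b) *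
        (ofGroup M γ ⊗ₜ ofGroup M γ) := by
  simp only [comulAux, LinearMap.comp_apply, LinearMap.lTensor_tmul, AlgHom.toLinearMap_apply]
  generalize NicholsAlgebra.coact M b = z
  induction z using TensorProduct.induction_on with
  | zero => simp
  | add x y hx hy => rw [TensorProduct.tmul_add, map_add, map_add, hx, hy, map_add, mul_add, add_mul]
  | tmul h s =>
    simp [smash, incl, ofGroupAlgebra_single, mul_assoc]

theorem comulAux_eq (γ : Γ) (X : M.NicholsAlgebra ⊗[k] M.NicholsAlgebra) :
    comulAux M γ X = comulAux M 1 X * (ofGroup M γ ⊗ₜ ofGroup M γ) := by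
  induction X using TensorProduct.induction_on with
  | zero => simp
  | add x y hx hy => rw [map_add, hx, hy, map_add, add_mul]
  | tmul a b =>
    rw [comulAux_tmul, comulAux_tmul, map_one, ← Algebra.TensorProduct.one_def, mul_one]

theorem comulAux_one :
    comulAux M 1 (TensorProduct.map (NicholsAlgebra.mk M).toLinearMap
      (NicholsAlgebra.mk M).toLinearMap (1 ⊗ₜ 1)) = 1 := by
  rw [TensorProduct.map_tmul]
  simp only [AlgHom.toLinearMap_apply]
  rw [map_one, comulAux_tmul]
  simp only [map_one, ← Algebra.TensorProduct.one_def, mul_one]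

theorem coact_ι_mul {g : Γ} {v : V} (hv : M.coact v = MonoidAlgebra.single g 1 ⊗ₜ v)
    (b : M.NicholsAlgebra) :
    NicholsAlgebra.coact M (NicholsAlgebra.ι M v * b) =
      (MonoidAlgebra.single g 1 ⊗ₜ NicholsAlgebra.ι M v) * NicholsAlgebra.coact M b := by
  rw [map_mul]
  congr 1
  change NicholsAlgebra.coact M (NicholsAlgebra.mk M (TensorAlgebra.ι k v)) = _
  rw [NicholsAlgebra.coact_mk, tCoact_ι, hv]
  simp [NicholsAlgebra.ι]

theorem comulAux_braidedMul {g : Γ} {v : V} (hv : M.coact v = MonoidAlgebra.single g 1 ⊗ₜ v)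
    (X : TensorAlgebra k V ⊗[k] TensorAlgebra k V) :
    comulAux M 1 (TensorProduct.map (NicholsAlgebra.mk M).toLinearMap
        (NicholsAlgebra.mk M).toLinearMap
          (M.braidedMul (TensorAlgebra.ι k v ⊗ₜ 1 + 1 ⊗ₜ TensorAlgebra.ι k v) X)) =
      (ofNichols M (NicholsAlgebra.ι M v) ⊗ₜ 1 +
          ofGroup M g ⊗ₜ ofNichols M (NicholsAlgebra.ι M v)) *
        comulAux M 1 (TensorProduct.map (NicholsAlgebra.mk M).toLinearMap
          (NicholsAlgebra.mk M).toLinearMap X) := by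
  induction X using TensorProduct.induction_on with
  | zero => simp
  | add x y hx hy =>
    rw [map_add (M.braidedMul _), map_add, map_add, hx, hy, map_add, map_add, mul_add]
  | tmul a b =>
    have h1 : ∀ t, NicholsAlgebra.mk M (TensorAlgebra.ι k v * t) =
        NicholsAlgebra.ι M v * NicholsAlgebra.mk M t := fun t => map_mul _ _ _
    rw [braidedMul_ι M hv, map_add, TensorProduct.map_tmul, TensorProduct.map_tmul,
      TensorProduct.map_tmul, map_add]
    simp only [AlgHom.toLinearMap_apply]
    rw [h1, h1, comulAux_tmul, comulAux_tmul, comulAux_tmul, coact_ι_mul M hv, ← NicholsAlgebra.smul_mk, map_mul (incl M)]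
    have h2 : incl M (MonoidAlgebra.single g 1 ⊗ₜ NicholsAlgebra.ι M v) =
        ofGroup M g ⊗ₜ ofNichols M (NicholsAlgebra.ι M v) := by
      simp [incl, ofGroupAlgebra_single]
    rw [h2, add_mul, map_mul, map_one, ← Algebra.TensorProduct.one_def, mul_one, mul_one, mul_one]
    congr 1
    · rw [← mul_assoc, Algebra.TensorProduct.tmul_mul_tmul, one_mul]
    · rw [← mul_assoc, ← mul_assoc, Algebra.TensorProduct.tmul_mul_tmul,
        Algebra.TensorProduct.tmul_mul_tmul, ofGroup_mul_ofNichols, one_mul, mul_one]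

/-- The algebra map on `T(V)` that induces the comultiplication of the bosonization. -/
def comulT : TensorAlgebra k V →ₐ[k] M.Bosonization ⊗[k] M.Bosonization :=
  TensorAlgebra.lift k
    (comulLinear M ∘ₗ (ofNichols M).toLinearMap ∘ₗ NicholsAlgebra.ι M)

theorem comulLinear_ofNichols_mk (t : TensorAlgebra k V) :
    comulLinear M (ofNichols M (NicholsAlgebra.mk M t)) =
      comulAux M 1 (TensorProduct.map (NicholsAlgebra.mk M).toLinearMap
        (NicholsAlgebra.mk M).toLinearMap (M.tComul t)) := by
  rw [ofNichols_apply, comulLinear_single, NicholsAlgebra.comul_mk]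

theorem comulLinear_one : comulLinear M 1 = 1 := by
  have h := comulLinear_ofNichols_mk M 1
  rw [map_one, map_one, tComul_one] at h
  rw [h, comulAux_one]

theorem comulLinear_ι {g : Γ} {v : V} (hv : M.coact v = MonoidAlgebra.single g 1 ⊗ₜ v) :
    comulLinear M (ofNichols M (NicholsAlgebra.ι M v)) =
      ofNichols M (NicholsAlgebra.ι M v) ⊗ₜ 1 +
        ofGroup M g ⊗ₜ ofNichols M (NicholsAlgebra.ι M v) := by
  have h := comulAux_braidedMul M hv (1 ⊗ₜ 1)
  have h2 := tComul_ι_mul M v 1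
  rw [tComul_one, mul_one] at h2
  rw [← h2, ← comulLinear_ofNichols_mk] at h
  exact h.trans (by rw [comulAux_one, mul_one])

theorem comulT_eq (t : TensorAlgebra k V) :
    comulT M t = comulLinear M (ofNichols M (NicholsAlgebra.mk M t)) := by
  have : (comulT M).toLinearMap =
      comulLinear M ∘ₗ (ofNichols M).toLinearMap ∘ₗ (NicholsAlgebra.mk M).toLinearMap := by
    refine tensor_hom_ext ?_ fun v t ht => ?_
    · simp [comulLinear_one]
    · have key : LinearMap.mulRight k (comulT M t) ∘ₗ (comulT M).toLinearMap ∘ₗ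
          TensorAlgebra.ι k = comulLinear M ∘ₗ (ofNichols M).toLinearMap ∘ₗ
            (NicholsAlgebra.mk M).toLinearMap ∘ₗ LinearMap.mulRight k t ∘ₗ
              TensorAlgebra.ι k := by
        refine M.hom_ext_homogeneous fun g v hv => ?_
        simp only [LinearMap.comp_apply, AlgHom.toLinearMap_apply, LinearMap.mulRight_apply] at ht ⊢
        rw [comulLinear_ofNichols_mk, tComul_ι_mul, comulAux_braidedMul M hv,
          ← comulLinear_ofNichols_mk, ← ht, comulT, TensorAlgebra.lift_ι_apply]
        simp only [LinearMap.comp_apply, AlgHom.toLinearMap_apply]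
        rw [comulLinear_ι M hv]
      simpa using LinearMap.congr_fun key v
  exact LinearMap.congr_fun this t

theorem comulLinear_ofNichols_mul (r s : M.NicholsAlgebra) :
    comulLinear M (ofNichols M (r * s)) =
      comulLinear M (ofNichols M r) * comulLinear M (ofNichols M s) := by
  obtain ⟨r, rfl⟩ := NicholsAlgebra.mk_surjective M r
  obtain ⟨s, rfl⟩ := NicholsAlgebra.mk_surjective M s
  rw [← map_mul, ← comulT_eq, ← comulT_eq, ← comulT_eq, map_mul]

/-- The restriction of the comultiplication to `𝔅(V)`, as an algebra map. -/
def comulN : M.NicholsAlgebra →ₐ[k] M.Bosonization ⊗[k] M.Bosonization :=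
  AlgHom.ofLinearMap (comulLinear M ∘ₗ (ofNichols M).toLinearMap)
    (by simp [comulLinear_one]) (comulLinear_ofNichols_mul M)

theorem comulN_ι {g : Γ} {v : V} (hv : M.coact v = MonoidAlgebra.single g 1 ⊗ₜ v) :
    comulN M (NicholsAlgebra.ι M v) =
      ofNichols M (NicholsAlgebra.ι M v) ⊗ₜ 1 +
        ofGroup M g ⊗ₜ ofNichols M (NicholsAlgebra.ι M v) :=
  comulLinear_ι M hv

theorem algHom_ext_homogeneous {B : Type*} [Ring B] [Algebra k B]
    {f f' : M.NicholsAlgebra →ₐ[k] B}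
    (h : ∀ (g : Γ) (v : V), M.coact v = MonoidAlgebra.single g 1 ⊗ₜ v →
      f (NicholsAlgebra.ι M v) = f' (NicholsAlgebra.ι M v)) : f = f' := by
  have : f.toLinearMap ∘ₗ NicholsAlgebra.ι M = f'.toLinearMap ∘ₗ NicholsAlgebra.ι M :=
    M.hom_ext_homogeneous h
  exact NicholsAlgebra.algHom_ext fun v => LinearMap.congr_fun this v

theorem coact_act_homogeneous {g : Γ} {v : V} (γ : Γ)
    (hv : M.coact v = MonoidAlgebra.single g 1 ⊗ₜ v) :
    M.coact (M.act γ v) = MonoidAlgebra.single g 1 ⊗ₜ M.act γ v := by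
  rw [coact_act, hv, LinearMap.lTensor_tmul]

theorem comulN_smul (γ : Γ) (r : M.NicholsAlgebra) :
    comulN M (γ • r) * (ofGroup M γ ⊗ₜ ofGroup M γ) =
      (ofGroup M γ ⊗ₜ ofGroup M γ) * comulN M r := by
  have hV : LinearMap.mulRight k (ofGroup M γ ⊗ₜ[k] ofGroup M γ) ∘ₗ (comulN M).toLinearMap ∘ₗ
      NicholsAlgebra.ι M ∘ₗ M.act γ =
      LinearMap.mulLeft k (ofGroup M γ ⊗ₜ[k] ofGroup M γ) ∘ₗ (comulN M).toLinearMap ∘ₗ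
        NicholsAlgebra.ι M := by
    refine M.hom_ext_homogeneous fun g v hv => ?_
    simp only [LinearMap.comp_apply, AlgHom.toLinearMap_apply, LinearMap.mulRight_apply,
      LinearMap.mulLeft_apply]
    rw [comulN_ι M hv, comulN_ι M (coact_act_homogeneous M γ hv), add_mul, mul_add,
      Algebra.TensorProduct.tmul_mul_tmul, Algebra.TensorProduct.tmul_mul_tmul,
      Algebra.TensorProduct.tmul_mul_tmul, Algebra.TensorProduct.tmul_mul_tmul,
      ofGroup_mul_ofNichols, NicholsAlgebra.smul_ι, one_mul, mul_one, ← map_mul, ← map_mul,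
      mul_comm g γ]
  obtain ⟨t, rfl⟩ := NicholsAlgebra.mk_surjective M r
  have : LinearMap.mulRight k (ofGroup M γ ⊗ₜ[k] ofGroup M γ) ∘ₗ (comulN M).toLinearMap ∘ₗ
      (NicholsAlgebra.act M γ).toLinearMap ∘ₗ (NicholsAlgebra.mk M).toLinearMap =
      LinearMap.mulLeft k (ofGroup M γ ⊗ₜ[k] ofGroup M γ) ∘ₗ (comulN M).toLinearMap ∘ₗ
        (NicholsAlgebra.mk M).toLinearMap := by
    refine tensor_hom_ext ?_ fun v t ht => ?_
    · simp
    · have h := LinearMap.congr_fun hV v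
      have h1 : NicholsAlgebra.act M γ (NicholsAlgebra.mk M (TensorAlgebra.ι k v)) =
          NicholsAlgebra.ι M (M.act γ v) := NicholsAlgebra.smul_ι M γ v
      have h2 : NicholsAlgebra.mk M (TensorAlgebra.ι k v) = NicholsAlgebra.ι M v := rfl
      simp only [LinearMap.comp_apply, AlgHom.toLinearMap_apply, LinearMap.mulRight_apply,
        LinearMap.mulLeft_apply] at h ht ⊢
      rw [map_mul, map_mul, map_mul, map_mul, mul_assoc, ht, ← mul_assoc, h1, h, h2, mul_assoc]
  exact LinearMap.congr_fun this t

theorem comulLinear_single' (γ : Γ) (r : M.NicholsAlgebra) :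
    comulLinear M (SkewMonoidAlgebra.single γ r) =
      comulN M r * (ofGroup M γ ⊗ₜ ofGroup M γ) := by
  rw [comulLinear_single, comulAux_eq, ← comulLinear_single]
  rfl

theorem comulLinear_mul (a b : M.Bosonization) :
    comulLinear M (a * b) = comulLinear M a * comulLinear M b := by
  induction a using SkewMonoidAlgebra.induction_on with
  | zero => simp
  | add x y hx hy => rw [add_mul, map_add, hx, hy, map_add, add_mul]
  | single γ r =>
    induction b using SkewMonoidAlgebra.induction_on with
    | zero => simp
    | add x y hx hy => rw [mul_add, map_add, hx, hy, map_add, mul_add]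
    | single γ' s =>
      rw [single_mul_single, comulLinear_single', comulLinear_single', comulLinear_single',
        map_mul, map_mul, ← Algebra.TensorProduct.tmul_mul_tmul, mul_assoc, ← mul_assoc _ _ (_ ⊗ₜ _),
        comulN_smul]
      simp only [mul_assoc]

/-- The comultiplication of the bosonization as an algebra map. -/
def comulHom : M.Bosonization →ₐ[k] M.Bosonization ⊗[k] M.Bosonization :=
  AlgHom.ofLinearMap (comulLinear M) (comulLinear_one M) (comulLinear_mul M)

theorem comulHom_ofGroup (γ : Γ) : comulHom M (ofGroup M γ) = ofGroup M γ ⊗ₜ ofGroup M γ := by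
  have := comulLinear_single' M γ 1
  rw [map_one, one_mul] at this
  exact this

theorem comulHom_ι {g : Γ} {v : V} (hv : M.coact v = MonoidAlgebra.single g 1 ⊗ₜ v) :
    comulHom M (ofNichols M (NicholsAlgebra.ι M v)) =
      ofNichols M (NicholsAlgebra.ι M v) ⊗ₜ 1 +
        ofGroup M g ⊗ₜ ofNichols M (NicholsAlgebra.ι M v) :=
  comulLinear_ι M hv

/-- Algebra maps on the bosonization that agree on `Γ` and on homogeneous vectors are equal. -/
theorem hom_ext {B : Type*} [Ring B] [Algebra k B] {f f' : M.Bosonization →ₐ[k] B}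
    (hΓ : ∀ γ, f (ofGroup M γ) = f' (ofGroup M γ))
    (hV : ∀ (g : Γ) (v : V), M.coact v = MonoidAlgebra.single g 1 ⊗ₜ v →
      f (ofNichols M (NicholsAlgebra.ι M v)) = f' (ofNichols M (NicholsAlgebra.ι M v))) :
    f = f' := by
  have h := algHom_ext_homogeneous M (f := f.comp (ofNichols M)) (f' := f'.comp (ofNichols M)) hV
  ext a
  induction a using SkewMonoidAlgebra.induction_on with
  | zero => simp
  | add x y hx hy => rw [map_add, map_add, hx, hy]
  | single γ r =>
    rw [← ofNichols_mul_ofGroup, map_mul, map_mul, hΓ]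
    congr 1
    exact DFunLike.congr_fun h r

theorem counitHom_ofGroup (γ : Γ) : counitHom M (ofGroup M γ) = 1 := by
  rw [ofGroup_apply, counitHom_single, map_one]

theorem counitHom_ι (v : V) : counitHom M (ofNichols M (NicholsAlgebra.ι M v)) = 0 := by
  rw [ofNichols_apply, counitHom_single, NicholsAlgebra.counit_ι]

/-- The bialgebra structure of the bosonization, with the comultiplication `comulLinear` and the
counit `counitHom` (see `comul_single` and `counit_single`). It has an antipode; bialgebra
automorphisms of a Hopf algebra automatically commute with the antipode, so that the Hopf algebra
automorphisms of the bosonization are its bialgebra automorphisms. -/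
instance : Bialgebra k M.Bosonization :=
  Bialgebra.ofAlgHom (comulHom M) (counitHom M)
    (hom_ext M (fun γ => by simp [comulHom_ofGroup])
      (fun g v hv => by
        simp [comulHom_ι M hv, comulHom_ofGroup, TensorProduct.add_tmul, TensorProduct.tmul_add,
          Algebra.TensorProduct.one_def, add_assoc]))
    (hom_ext M (fun γ => by simp [comulHom_ofGroup, counitHom_ofGroup])
      (fun g v hv => by simp [comulHom_ι M hv, counitHom_ofGroup, counitHom_ι]))
    (hom_ext M (fun γ => by simp [comulHom_ofGroup, counitHom_ofGroup])
      (fun g v hv => by simp [comulHom_ι M hv, counitHom_ofGroup, counitHom_ι]))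

theorem comul_single (γ : Γ) (r : M.NicholsAlgebra) :
    Coalgebra.comul (R := k) (SkewMonoidAlgebra.single γ r : M.Bosonization) =
      comulAux M γ (NicholsAlgebra.comul M r) :=
  comulLinear_single M γ r

theorem counit_single (γ : Γ) (r : M.NicholsAlgebra) :
    Coalgebra.counit (R := k) (SkewMonoidAlgebra.single γ r : M.Bosonization) =
      NicholsAlgebra.counit M r :=
  counitHom_single M γ r

end Bosonization

end

end YDModule

/-! An automorphism of `𝔅(V) # kΓ` is determined by its values on `Γ` and on `V`, since these
generate the algebra. The theorem follows once both subsets are known to be preserved and every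
admissible pair is known to extend.

From automorphisms to pairs: `Φ` permutes the group-like elements, and these are exactly the
elements of `Γ` (`exists_eq_ofGroup`), which gives `ψ`. The image of `x_i` is skew primitive for `ψ
(g_i)`, and `Γ` acts on it by `χ_i ∘ ψ⁻¹`. This character is nontrivial, which rules out the
multiples of `1 - g`, so the image lies in `V` (`exists_eq_ι_of_skewPrimitive`). As the pairs `(g_j,
χ_j)` are distinct, the joint eigenspaces in `V` are the lines spanned by the `x_j`
(`exists_eq_smul_basis`). Hence `Φ` permutes these lines (`exists_pair_of_bialgEquiv`).

The core is that primitive homogeneous eigenvectors of `𝔅(V)` lie in `V`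
(`exists_eq_ι_of_primitive`). The comultiplication is graded, so the homogeneous components of a
primitive element are primitive. A primitive component of degree at least two could be adjoined to
the defining ideal without destroying the Hopf ideal conditions (`isHopfIdeal_extIdeal`), so it
vanishes by maximality. Group-like and skew primitive elements of the bosonization are reduced to
`𝔅(V)` by taking coefficients along `Γ`.

From pairs to automorphisms: a pair `(φ, ψ)` is an automorphism of the Yetter-Drinfeld module
twisted by `ψ`. The induced automorphism of `T(V)` pulls Hopf ideals back to Hopf ideals, so it
preserves the largest one (`tMap_mem_nicholsIdeal`) and descends to `𝔅(V)` and to the bosonization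
(`bosonizationEquiv`). -/

namespace YDModule

noncomputable section

variable {k Γ V : Type*} [Field k] [CommGroup Γ] [AddCommGroup V] [Module k V]

/-! ### Projections onto the homogeneous components -/

/-- The projection of `T(V)` onto its component of degree `n`. -/
def tProj (M : YDModule k Γ V) (n : ℕ) : TensorAlgebra k V →ₗ[k] TensorAlgebra k V :=
  GradedAlgebra.proj M.tGrading n

theorem ι_mem_tGrading (M : YDModule k Γ V) (v : V) : TensorAlgebra.ι k v ∈ M.tGrading 1 := by
  simp [tGrading]

theorem tProj_ι_mul_zero (M : YDModule k Γ V) (v : V) (t : TensorAlgebra k V) :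
    M.tProj 0 (TensorAlgebra.ι k v * t) = 0 :=
  DirectSum.coe_decompose_mul_of_left_mem_of_not_le M.tGrading (M.ι_mem_tGrading v) (by norm_num)

theorem tProj_ι_mul_succ (M : YDModule k Γ V) (n : ℕ) (v : V) (t : TensorAlgebra k V) :
    M.tProj (n + 1) (TensorAlgebra.ι k v * t) = TensorAlgebra.ι k v * M.tProj n t := by
  have h := DirectSum.coe_decompose_mul_add_of_left_mem M.tGrading (j := n) (b := t)
    (M.ι_mem_tGrading v)
  rwa [add_comm 1 n] at h

theorem tProj_mem (M : YDModule k Γ V) (n : ℕ) (t : TensorAlgebra k V) :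
    M.tProj n t ∈ M.tGrading n :=
  SetLike.coe_mem (DirectSum.decompose M.tGrading t n)

theorem tProj_of_mem (M : YDModule k Γ V) {n : ℕ} {t : TensorAlgebra k V}
    (ht : t ∈ M.tGrading n) : M.tProj n t = t :=
  DirectSum.decompose_of_mem_same M.tGrading ht

theorem tProj_of_mem_ne (M : YDModule k Γ V) {m n : ℕ} (hmn : m ≠ n) {t : TensorAlgebra k V}
    (ht : t ∈ M.tGrading m) : M.tProj n t = 0 :=
  DirectSum.decompose_of_mem_ne M.tGrading ht hmn

theorem tProj_tProj_same (M : YDModule k Γ V) (n : ℕ) (t : TensorAlgebra k V) :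
    M.tProj n (M.tProj n t) = M.tProj n t :=
  M.tProj_of_mem (M.tProj_mem n t)

theorem tProj_tProj_ne (M : YDModule k Γ V) {m n : ℕ} (hmn : m ≠ n) (t : TensorAlgebra k V) :
    M.tProj n (M.tProj m t) = 0 :=
  M.tProj_of_mem_ne hmn (M.tProj_mem m t)

theorem tProj_one_zero (M : YDModule k Γ V) : M.tProj 0 1 = 1 :=
  M.tProj_of_mem SetLike.GradedOne.one_mem

theorem tProj_one_succ (M : YDModule k Γ V) (n : ℕ) : M.tProj (n + 1) 1 = 0 :=
  M.tProj_of_mem_ne (m := 0) (by omega) SetLike.GradedOne.one_mem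

/-- Membership in a subspace of `T(V)` may be checked by left multiplication with homogeneous
vectors. -/
theorem mem_of_homogeneous_mul_mem (M : YDModule k Γ V) (C : Submodule k (TensorAlgebra k V))
    (h1 : 1 ∈ C)
    (hι : ∀ (g : Γ) (v : V), M.coact v = MonoidAlgebra.single g 1 ⊗ₜ[k] v →
      ∀ t ∈ C, TensorAlgebra.ι k v * t ∈ C) (t : TensorAlgebra k V) : t ∈ C := by
  refine mem_of_ι_mul_mem C h1 (fun v t ht => ?_) t
  have hv : v ∈ Submodule.span k
      {v : V | ∃ g : Γ, M.coact v = MonoidAlgebra.single g 1 ⊗ₜ[k] v} := by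
    rw [M.span_homogeneous]; trivial
  have hle : Submodule.span k {v : V | ∃ g : Γ, M.coact v = MonoidAlgebra.single g 1 ⊗ₜ[k] v} ≤
      C.comap (LinearMap.mulRight k t ∘ₗ TensorAlgebra.ι k) :=
    Submodule.span_le.2 fun w ⟨g, hw⟩ => hι g w hw t ht
  exact hle hv

/-- Algebra endomorphisms of `T(V)` induced by linear endomorphisms of `V` are graded. -/
theorem tProj_algHom (M : YDModule k Γ V) (F : TensorAlgebra k V →ₐ[k] TensorAlgebra k V)
    (f : V → V) (hF : ∀ v, F (TensorAlgebra.ι k v) = TensorAlgebra.ι k (f v)) (n : ℕ)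
    (t : TensorAlgebra k V) : M.tProj n (F t) = F (M.tProj n t) := by
  -- All degrees are treated at once: multiplication by a vector relates degree `n + 1` to degree
  -- `n`, so the subspace that carries the induction is the intersection over all `n`.
  have := mem_of_ι_mul_mem
    (⨅ n, LinearMap.eqLocus (M.tProj n ∘ₗ F.toLinearMap) (F.toLinearMap ∘ₗ M.tProj n))
    ?_ ?_ t
  · exact (Submodule.mem_iInf _).1 this n
  · refine (Submodule.mem_iInf _).2 fun n => ?_
    rw [LinearMap.mem_eqLocus]
    cases n <;> simp [tProj_one_zero, tProj_one_succ]
  · intro v t ht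
    refine (Submodule.mem_iInf _).2 fun n => ?_
    have ht' : ∀ n, M.tProj n (F t) = F (M.tProj n t) := (Submodule.mem_iInf _).1 ht
    rw [LinearMap.mem_eqLocus]
    cases n <;> simp [tProj_ι_mul_zero, tProj_ι_mul_succ, hF, ht']

theorem tProj_tAct (M : YDModule k Γ V) (γ : Γ) (n : ℕ) (t : TensorAlgebra k V) :
    M.tProj n (M.tAct γ t) = M.tAct γ (M.tProj n t) :=
  M.tProj_algHom (M.tAct γ) (M.act γ) (M.tAct_ι γ) n t

theorem lTensor_tProj_single_mul_zero (M : YDModule k Γ V) (g : Γ) (v : V)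
    (z : MonoidAlgebra k Γ ⊗[k] TensorAlgebra k V) :
    (M.tProj 0).lTensor (MonoidAlgebra k Γ)
      ((MonoidAlgebra.single g 1 ⊗ₜ TensorAlgebra.ι k v) * z) = 0 := by
  induction z using TensorProduct.induction_on with
  | zero => simp
  | add x y hx hy => rw [mul_add, map_add, hx, hy, add_zero]
  | tmul _ t => simp [tProj_ι_mul_zero]

theorem lTensor_tProj_single_mul_succ (M : YDModule k Γ V) (n : ℕ) (g : Γ) (v : V)
    (z : MonoidAlgebra k Γ ⊗[k] TensorAlgebra k V) :
    (M.tProj (n + 1)).lTensor (MonoidAlgebra k Γ)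
      ((MonoidAlgebra.single g 1 ⊗ₜ TensorAlgebra.ι k v) * z) =
    (MonoidAlgebra.single g 1 ⊗ₜ TensorAlgebra.ι k v) *
      (M.tProj n).lTensor (MonoidAlgebra k Γ) z := by
  induction z using TensorProduct.induction_on with
  | zero => simp
  | add x y hx hy => rw [mul_add, map_add, hx, hy, map_add, mul_add]
  | tmul _ t => simp [tProj_ι_mul_succ]

theorem lTensor_tProj_tCoact (M : YDModule k Γ V) (n : ℕ) (t : TensorAlgebra k V) :
    (M.tProj n).lTensor (MonoidAlgebra k Γ) (M.tCoact t) = M.tCoact (M.tProj n t) := by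
  have := M.mem_of_homogeneous_mul_mem
    (⨅ n, LinearMap.eqLocus ((M.tProj n).lTensor (MonoidAlgebra k Γ) ∘ₗ M.tCoact.toLinearMap)
      (M.tCoact.toLinearMap ∘ₗ M.tProj n)) ?_ ?_ t
  · exact (Submodule.mem_iInf _).1 this n
  · refine (Submodule.mem_iInf _).2 fun n => ?_
    rw [LinearMap.mem_eqLocus]
    cases n <;> simp [tProj_one_zero, tProj_one_succ, Algebra.TensorProduct.one_def]
  · intro g v hv t ht
    refine (Submodule.mem_iInf _).2 fun n => ?_
    have ht' : ∀ n, (M.tProj n).lTensor (MonoidAlgebra k Γ) (M.tCoact t) =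
      M.tCoact (M.tProj n t) := (Submodule.mem_iInf _).1 ht
    have hc : M.tCoact (TensorAlgebra.ι k v) =
        MonoidAlgebra.single g 1 ⊗ₜ TensorAlgebra.ι k v := by
      rw [tCoact_ι, hv, LinearMap.lTensor_tmul]
    rw [LinearMap.mem_eqLocus]
    simp only [LinearMap.comp_apply, AlgHom.toLinearMap_apply, map_mul, hc]
    cases n with
    | zero => rw [lTensor_tProj_single_mul_zero, tProj_ι_mul_zero, map_zero]
    | succ n => rw [lTensor_tProj_single_mul_succ, tProj_ι_mul_succ, ht', map_mul, hc]

/-- The left multiplication by `v ⊗ 1 + 1 ⊗ v`, for `v` of degree `g`, as a sum of two maps. -/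
theorem tComul_homogeneous_mul (M : YDModule k Γ V) {g : Γ} {v : V}
    (hv : M.coact v = MonoidAlgebra.single g 1 ⊗ₜ v) (t : TensorAlgebra k V) :
    M.tComul (TensorAlgebra.ι k v * t) =
      TensorProduct.map (LinearMap.mulLeft k (TensorAlgebra.ι k v)) LinearMap.id (M.tComul t) +
      TensorProduct.map (M.tAct g).toLinearMap (LinearMap.mulLeft k (TensorAlgebra.ι k v))
        (M.tComul t) := by
  rw [tComul_ι_mul, ← LinearMap.add_apply]
  refine LinearMap.congr_fun (TensorProduct.ext' fun a b => ?_) _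
  rw [braidedMul_ι M hv]
  simp

/-- This is the gradedness of `Δ`, stated so that no grading on the tensor square is needed. The
induction multiplies by a homogeneous vector, which raises either the left or the right degree by
one. -/
theorem map_tProj_tComul (M : YDModule k Γ V) (i j : ℕ) (t : TensorAlgebra k V) :
    TensorProduct.map (M.tProj i) (M.tProj j) (M.tComul t) =
      TensorProduct.map (M.tProj i) (M.tProj j) (M.tComul (M.tProj (i + j) t)) := by
  let f (p : ℕ × ℕ) := TensorProduct.map (M.tProj p.1) (M.tProj p.2) ∘ₗ M.tComul
  have := M.mem_of_homogeneous_mul_mem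
    (⨅ p : ℕ × ℕ, LinearMap.eqLocus (f p) (f p ∘ₗ M.tProj (p.1 + p.2))) ?_ ?_ t
  · exact (Submodule.mem_iInf _).1 this (i, j)
  · refine (Submodule.mem_iInf _).2 fun p => ?_
    obtain ⟨i, j⟩ := p
    rw [LinearMap.mem_eqLocus]
    obtain h | h : i + j = 0 ∨ ∃ m, i + j = m + 1 := by
      cases h : i + j <;> simp
    · simp only [f, LinearMap.comp_apply, h, tProj_one_zero]
    · obtain ⟨m, hm⟩ := h
      simp only [f, LinearMap.comp_apply, hm, tProj_one_succ, tComul_one, map_zero,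
        TensorProduct.map_tmul]
      cases i with
      | succ i => rw [tProj_one_succ, TensorProduct.zero_tmul]
      | zero =>
        cases j with
        | succ j => rw [tProj_one_succ, TensorProduct.tmul_zero]
        | zero => omega
  · intro g v hv t ht
    refine (Submodule.mem_iInf _).2 fun p => ?_
    obtain ⟨i, j⟩ := p
    have ht' : ∀ i j, TensorProduct.map (M.tProj i) (M.tProj j) (M.tComul t) =
        TensorProduct.map (M.tProj i) (M.tProj j) (M.tComul (M.tProj (i + j) t)) :=
      fun i j => (Submodule.mem_iInf _).1 ht (i, j)
    set m := TensorAlgebra.ι k v with hm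
    have L0 : M.tProj 0 ∘ₗ LinearMap.mulLeft k m = 0 :=
      LinearMap.ext fun t => M.tProj_ι_mul_zero v t
    have LS : ∀ n, M.tProj (n + 1) ∘ₗ LinearMap.mulLeft k m = LinearMap.mulLeft k m ∘ₗ M.tProj n :=
      fun n => LinearMap.ext (M.tProj_ι_mul_succ n v)
    have A : ∀ n, M.tProj n ∘ₗ (M.tAct g).toLinearMap = (M.tAct g).toLinearMap ∘ₗ M.tProj n :=
      fun n => LinearMap.ext fun t => M.tProj_tAct g n t
    have key : ∀ s, f (i, j) (m * s) =
        TensorProduct.map (M.tProj i ∘ₗ LinearMap.mulLeft k m) (LinearMap.id ∘ₗ M.tProj j)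
          (M.tComul s) +
        TensorProduct.map ((M.tAct g).toLinearMap ∘ₗ M.tProj i) (M.tProj j ∘ₗ LinearMap.mulLeft k m)
          (M.tComul s) := by
      intro s
      simp only [f, LinearMap.comp_apply]
      rw [M.tComul_homogeneous_mul hv, map_add, ← LinearMap.comp_apply, ← TensorProduct.map_comp,
        ← LinearMap.comp_apply (TensorProduct.map (M.tProj i) (M.tProj j)),
        ← TensorProduct.map_comp, A, LinearMap.comp_id, LinearMap.id_comp]
    rw [LinearMap.mem_eqLocus]
    change f (i, j) (m * t) = f (i, j) (M.tProj (i + j) (m * t))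
    rw [key]
    -- By `L0`, the first summand of `key` dies when `i = 0` and the second when `j = 0`; in the
    -- remaining cases `LS` lowers the index and `ht'` applies.
    cases i with
    | zero =>
      cases j with
      | zero => rw [add_zero, tProj_ι_mul_zero, L0, map_zero]; simp
      | succ j =>
        rw [← add_assoc, tProj_ι_mul_succ, key, L0, LS, TensorProduct.map_zero_left,
          TensorProduct.map_comp, LinearMap.comp_apply, ht']
        simp
    | succ i =>
      cases j with
      | zero =>
        rw [add_zero, tProj_ι_mul_succ, key, L0, LS, TensorProduct.map_zero_right,
          TensorProduct.map_comp, LinearMap.comp_apply, ht']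
        simp
      | succ j =>
        have e : i + 1 + (j + 1) = (i + j + 1) + 1 := by omega
        have h1 := ht' i (j + 1)
        have h2 := ht' (i + 1) j
        rw [← add_assoc] at h1
        rw [add_right_comm] at h2
        rw [e, tProj_ι_mul_succ, key, LS, LS, TensorProduct.map_comp, TensorProduct.map_comp]
        simp only [LinearMap.comp_apply]
        rw [h1, h2]

/-- The form with `∀ᶠ` lets several elements share one truncation degree. -/
theorem eventually_sum_tProj (M : YDModule k Γ V) (t : TensorAlgebra k V) :
    ∀ᶠ n in Filter.atTop, ∑ i ∈ Finset.range n, M.tProj i t = t := by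
  classical
  have h := DirectSum.sum_support_decompose M.tGrading t
  obtain ⟨N, hN⟩ := (DFinsupp.support (DirectSum.decompose M.tGrading t)).exists_nat_subset_range
  refine Filter.eventually_atTop.2 ⟨N, fun n hn => ?_⟩
  conv_rhs => rw [← h]
  symm
  refine Finset.sum_subset (hN.trans (Finset.range_subset_range.2 hn)) fun i _ hi => ?_
  simpa using hi

/-! ### The grading of the Nichols algebra. -/

namespace NicholsAlgebra

variable (M : YDModule k Γ V)

/-- The projection of `𝔅(V)` onto its component of degree `n`. -/
def proj (n : ℕ) : M.NicholsAlgebra →ₗ[k] M.NicholsAlgebra :=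
  liftLinear M ((mk M).toLinearMap ∘ₗ M.tProj n) fun _ ht =>
    (mk_eq_zero M _).2 (M.isHopfIdeal_nicholsIdeal.isHomogeneous n ht)

theorem proj_mk (n : ℕ) (t : TensorAlgebra k V) : proj M n (mk M t) = mk M (M.tProj n t) :=
  rfl

theorem proj_proj_same (n : ℕ) (r : M.NicholsAlgebra) : proj M n (proj M n r) = proj M n r := by
  obtain ⟨t, rfl⟩ := mk_surjective M r
  rw [proj_mk, proj_mk, tProj_tProj_same]

theorem proj_proj_ne {m n : ℕ} (hmn : m ≠ n) (r : M.NicholsAlgebra) :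
    proj M n (proj M m r) = 0 := by
  obtain ⟨t, rfl⟩ := mk_surjective M r
  rw [proj_mk, proj_mk, tProj_tProj_ne M hmn, map_zero]

theorem proj_one_of_ne {n : ℕ} (hn : n ≠ 0) : proj M n 1 = 0 := by
  obtain ⟨n, rfl⟩ := Nat.exists_eq_succ_of_ne_zero hn
  rw [← map_one (mk M), proj_mk, tProj_one_succ, map_zero]

theorem smul_proj (γ : Γ) (n : ℕ) (r : M.NicholsAlgebra) :
    γ • proj M n r = proj M n (γ • r) := by
  obtain ⟨t, rfl⟩ := mk_surjective M r
  rw [proj_mk, smul_mk, smul_mk, proj_mk, tProj_tAct]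

theorem coact_proj (n : ℕ) (r : M.NicholsAlgebra) :
    coact M (proj M n r) = (proj M n).lTensor (MonoidAlgebra k Γ) (coact M r) := by
  obtain ⟨t, rfl⟩ := mk_surjective M r
  rw [proj_mk, coact_mk, coact_mk, ← lTensor_tProj_tCoact]
  generalize M.tCoact t = z
  induction z using TensorProduct.induction_on with
  | zero => simp
  | add x y hx hy => simp only [map_add, hx, hy]
  | tmul a _ => simp [proj_mk]

theorem map_proj_comul (i j : ℕ) (r : M.NicholsAlgebra) :
    TensorProduct.map (proj M i) (proj M j) (comul M r) =
      TensorProduct.map (proj M i) (proj M j) (comul M (proj M (i + j) r)) := by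
  obtain ⟨t, rfl⟩ := mk_surjective M r
  have h : ∀ n, proj M n ∘ₗ (mk M).toLinearMap = (mk M).toLinearMap ∘ₗ M.tProj n := fun n => rfl
  have h' : ∀ z, TensorProduct.map (proj M i) (proj M j)
      (TensorProduct.map (mk M).toLinearMap (mk M).toLinearMap z) =
      TensorProduct.map (mk M).toLinearMap (mk M).toLinearMap
        (TensorProduct.map (M.tProj i) (M.tProj j) z) := fun z => by
    rw [← LinearMap.comp_apply, ← TensorProduct.map_comp, h, h, TensorProduct.map_comp,
      LinearMap.comp_apply]
  rw [proj_mk, comul_mk, comul_mk, h', h', map_tProj_tComul]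

theorem map_proj_comul_proj_ne {i j n : ℕ} (h : i + j ≠ n) (r : M.NicholsAlgebra) :
    TensorProduct.map (proj M i) (proj M j) (comul M (proj M n r)) = 0 := by
  rw [map_proj_comul, proj_proj_ne M h.symm, map_zero, map_zero]

theorem eventually_sum_proj (r : M.NicholsAlgebra) :
    ∀ᶠ n in Filter.atTop, ∑ i ∈ Finset.range n, proj M i r = r := by
  obtain ⟨t, rfl⟩ := mk_surjective M r
  filter_upwards [M.eventually_sum_tProj t] with n hn
  simp_rw [proj_mk]
  rw [← map_sum, hn]

theorem eventually_map_sum_proj (z : M.NicholsAlgebra ⊗[k] M.NicholsAlgebra) :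
    ∀ᶠ n in Filter.atTop, TensorProduct.map (∑ i ∈ Finset.range n, proj M i)
      (∑ i ∈ Finset.range n, proj M i) z = z := by
  induction z using TensorProduct.induction_on with
  | zero => simp
  | add x y hx hy =>
    filter_upwards [hx, hy] with n hx hy
    rw [map_add, hx, hy]
  | tmul a b =>
    filter_upwards [eventually_sum_proj M a, eventually_sum_proj M b] with n ha hb
    rw [TensorProduct.map_tmul, LinearMap.sum_apply, LinearMap.sum_apply, ha, hb]

/-- Both tensors are the sum of their bihomogeneous components up to a common finite degree. -/
theorem tensor_ext {z w : M.NicholsAlgebra ⊗[k] M.NicholsAlgebra}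
    (h : ∀ i j, TensorProduct.map (proj M i) (proj M j) z =
      TensorProduct.map (proj M i) (proj M j) w) : z = w := by
  obtain ⟨n, hz, hw⟩ := ((eventually_map_sum_proj M z).and (eventually_map_sum_proj M w)).exists
  rw [← hz, ← hw]
  simp only [← TensorProduct.mapBilinear_apply, map_sum, LinearMap.sum_apply]
  refine Finset.sum_congr rfl fun i _ => Finset.sum_congr rfl fun j _ => ?_
  exact h _ _

theorem proj_zero (r : M.NicholsAlgebra) : proj M 0 r = algebraMap k _ (counit M r) := by
  obtain ⟨t, rfl⟩ := mk_surjective M r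
  rw [proj_mk]
  have h := LinearMap.congr_fun M.algebraMapInv_eq_proj t
  change _ = M.tProj 0 t at h
  rw [← h]
  change mk M (algebraMap k _ _) = _
  rw [AlgHom.commutes]
  rfl

theorem proj_one_eq_ι (r : M.NicholsAlgebra) : ∃ v, proj M 1 r = ι M v := by
  obtain ⟨t, rfl⟩ := mk_surjective M r
  have h := M.tProj_mem 1 t
  rw [tGrading, pow_one] at h
  obtain ⟨v, hv⟩ := h
  exact ⟨v, by rw [proj_mk, ← hv]; rfl⟩

/-- The defining ideal has no component in degree one. -/
theorem ι_injective : Function.Injective (ι M) := by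
  rw [← LinearMap.ker_eq_bot, LinearMap.ker_eq_bot']
  intro v hv
  have h := M.isHopfIdeal_nicholsIdeal.proj_eq_zero _ ((mk_eq_zero M _).1 hv) 1 (by norm_num)
  have h' := M.tProj_of_mem (M.ι_mem_tGrading v)
  change M.tProj 1 _ = 0 at h
  rw [h] at h'
  exact (TensorAlgebra.ι_eq_zero_iff k v).1 h'.symm

theorem coact_ι (v : V) :
    coact M (ι M v) = (ι M).lTensor (MonoidAlgebra k Γ) (M.coact v) := by
  change coact M (mk M (TensorAlgebra.ι k v)) = _
  rw [coact_mk, tCoact_ι]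
  change ((mk M).toLinearMap.lTensor _) _ = _
  rw [← LinearMap.comp_apply, ← LinearMap.lTensor_comp]
  rfl

end NicholsAlgebra

/-! ### Kernels of tensor products of linear maps -/

section Kernels

variable {T W P : Type*} [AddCommGroup T] [Module k T] [AddCommGroup W] [Module k W]
  [AddCommGroup P] [Module k P]

/-- Right exactness of the tensor product. This and the next lemma turn the coaction and coideal
conditions of `IsHopfIdeal` into the vanishing of an element under a quotient map. -/
theorem mem_range_lTensor_iff {q : T →ₗ[k] W} (hq : Function.Surjective q) {J : Submodule k T}
    (hJ : LinearMap.ker q = J) (z : P ⊗[k] T) :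
    z ∈ LinearMap.range (J.subtype.lTensor P) ↔ q.lTensor P z = 0 := by
  have h : Function.Exact J.subtype q := by
    rw [LinearMap.exact_iff, hJ, Submodule.range_subtype]
  exact (lTensor_exact P h hq z).symm

theorem mem_range_rTensor_sup_range_lTensor_iff {q : T →ₗ[k] W} (hq : Function.Surjective q)
    {J : Submodule k T} (hJ : LinearMap.ker q = J) (z : T ⊗[k] T) :
    z ∈ LinearMap.range (J.subtype.rTensor T) ⊔ LinearMap.range (J.subtype.lTensor T) ↔
      TensorProduct.map q q z = 0 := by
  have h : Function.Exact J.subtype q := by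
    rw [LinearMap.exact_iff, hJ, Submodule.range_subtype]
  rw [sup_comm, ← TensorProduct.map_ker h hq h hq, LinearMap.mem_ker]

theorem map_map_apply_eq_zero {q : T →ₗ[k] W} (hq : Function.Surjective q)
    {f f' : T →ₗ[k] T} (hf : ∀ t, q t = 0 → q (f t) = 0) (hf' : ∀ t, q t = 0 → q (f' t) = 0)
    {z : T ⊗[k] T} (hz : TensorProduct.map q q z = 0) :
    TensorProduct.map q q (TensorProduct.map f f' z) = 0 := by
  obtain ⟨x, ⟨x', rfl⟩, y, ⟨y', rfl⟩, rfl⟩ := Submodule.mem_sup.1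
    ((mem_range_rTensor_sup_range_lTensor_iff hq rfl z).2 hz)
  have h : (q ∘ₗ f) ∘ₗ (LinearMap.ker q).subtype = 0 := LinearMap.ext fun t => hf t t.2
  have h' : (q ∘ₗ f') ∘ₗ (LinearMap.ker q).subtype = 0 := LinearMap.ext fun t => hf' t t.2
  have comp : ∀ {X Y : Type _} [AddCommGroup X] [AddCommGroup Y] [Module k X] [Module k Y]
      (u : X →ₗ[k] T) (u' : Y →ₗ[k] T) (w : X ⊗[k] Y),
      TensorProduct.map q q (TensorProduct.map f f' (TensorProduct.map u u' w)) =
        TensorProduct.map ((q ∘ₗ f) ∘ₗ u) ((q ∘ₗ f') ∘ₗ u') w := fun u u' w => by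
    simp only [TensorProduct.map_comp, LinearMap.comp_apply]
  rw [map_add, map_add, LinearMap.rTensor, LinearMap.lTensor, comp, comp, h, h',
    TensorProduct.map_zero_left, TensorProduct.map_zero_right, LinearMap.zero_apply,
    LinearMap.zero_apply, add_zero]

end Kernels

/-! ### Primitive elements of the Nichols algebra -/

theorem tActMul_single_eq_map (M : YDModule k Γ V) (γ : Γ) (y : TensorAlgebra k V) :
    M.tActMul (MonoidAlgebra.single γ 1 ⊗ₜ y) =
      TensorProduct.map (M.tAct γ).toLinearMap (LinearMap.mulLeft k y) :=
  end_ext fun a b => by rw [tActMul_single]; rfl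

theorem single_tmul_eq {k Γ : Type*} [Field k] {W : Type*} [AddCommGroup W] [Module k W]
    (γ : Γ) (c : k) (w : W) :
    (MonoidAlgebra.single γ c ⊗ₜ[k] w) = MonoidAlgebra.single γ 1 ⊗ₜ[k] (c • w) := by
  rw [← TensorProduct.smul_tmul, MonoidAlgebra.smul_single, smul_eq_mul, mul_one]

/-! ### The kernel of `q ⊗ q` as an ideal of the braided tensor product. -/

section Quotient

variable {M : YDModule k Γ V} {B : Type*} [Ring B] [Algebra k B] {q : TensorAlgebra k V →ₐ[k] B}

theorem tActMul_mem_ker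
    (hq : Function.Surjective q) (hact : ∀ γ t, q t = 0 → q (M.tAct γ t) = 0)
    (w : MonoidAlgebra k Γ ⊗[k] TensorAlgebra k V)
    {z : TensorAlgebra k V ⊗[k] TensorAlgebra k V}
    (hz : TensorProduct.map q.toLinearMap q.toLinearMap z = 0) :
    TensorProduct.map q.toLinearMap q.toLinearMap (M.tActMul w z) = 0 := by
  induction w using TensorProduct.induction_on with
  | zero => simp
  | add x y hx hy => rw [map_add, LinearMap.add_apply, map_add, hx, hy, add_zero]
  | tmul a y =>
    induction a using MonoidAlgebra.induction_linear with
    | zero => simp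
    | add a b ha hb =>
      rw [TensorProduct.add_tmul, map_add, LinearMap.add_apply, map_add, ha, hb, add_zero]
    | single γ c =>
      rw [single_tmul_eq, tActMul_single_eq_map]
      refine map_map_apply_eq_zero (q := q.toLinearMap) hq (f := (M.tAct γ).toLinearMap)
        (hact γ) (fun t ht => ?_) hz
      have ht : q t = 0 := ht
      simp [ht]

/-- The kernel of `q ⊗ q` is a left ideal for the braided multiplication. In `x (y₋₁.u) ⊗ y₀ v` the
group acts on the right factor `z`, so only stability of `ker q` under the action matters. -/
theorem braidedMul_mem_ker
    (hq : Function.Surjective q) (hact : ∀ γ t, q t = 0 → q (M.tAct γ t) = 0)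
    (X : TensorAlgebra k V ⊗[k] TensorAlgebra k V)
    {z : TensorAlgebra k V ⊗[k] TensorAlgebra k V}
    (hz : TensorProduct.map q.toLinearMap q.toLinearMap z = 0) :
    TensorProduct.map q.toLinearMap q.toLinearMap (M.braidedMul X z) = 0 := by
  induction X using TensorProduct.induction_on with
  | zero => simp
  | add x y hx hy => rw [map_add, LinearMap.add_apply, map_add, hx, hy, add_zero]
  | tmul x y =>
    rw [braidedMul_tmul, Module.End.mul_apply]
    refine map_map_apply_eq_zero (q := q.toLinearMap) hq (fun t ht => ?_) (fun t ht => ht)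
      (tActMul_mem_ker hq hact _ hz)
    have ht : q t = 0 := ht
    simp [ht]

/-- The right ideal counterpart. Here the left factor lies in the kernel: if `q y = 0`, then `y₀ v`
must be killed, so what matters is stability of `ker q` under the coaction. -/
theorem braidedMul_mem_ker'
    (hq : Function.Surjective q) (hcoact : ∀ t, q t = 0 →
      q.toLinearMap.lTensor (MonoidAlgebra k Γ) (M.tCoact t) = 0)
    (X : TensorAlgebra k V ⊗[k] TensorAlgebra k V)
    {z : TensorAlgebra k V ⊗[k] TensorAlgebra k V}
    (hz : TensorProduct.map q.toLinearMap q.toLinearMap z = 0) :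
    TensorProduct.map q.toLinearMap q.toLinearMap (M.braidedMul z X) = 0 := by
  obtain ⟨x, ⟨x', rfl⟩, y, ⟨y', rfl⟩, rfl⟩ := Submodule.mem_sup.1
    ((mem_range_rTensor_sup_range_lTensor_iff (q := q.toLinearMap) hq rfl z).2 hz)
  rw [map_add, LinearMap.add_apply, map_add]
  have h0 : ∀ x, q x = 0 → q.toLinearMap ∘ₗ LinearMap.mulLeft k x = 0 := fun x hx =>
    LinearMap.ext fun s => by simp [hx]
  clear hz
  have h1 : TensorProduct.map q.toLinearMap q.toLinearMap
      (M.braidedMul ((LinearMap.ker q.toLinearMap).subtype.rTensor _ x') X) = 0 := by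
    induction x' using TensorProduct.induction_on with
    | zero => simp
    | add x y hx hy => rw [map_add, map_add, LinearMap.add_apply, map_add, hx, hy, add_zero]
    | tmul x y =>
      rw [LinearMap.rTensor_tmul, braidedMul_tmul, Module.End.mul_apply, LinearMap.rTensor,
        ← LinearMap.comp_apply, ← TensorProduct.map_comp, Submodule.subtype_apply, h0 x x.2,
        TensorProduct.map_zero_left, LinearMap.zero_apply]
  have h2 : TensorProduct.map q.toLinearMap q.toLinearMap
      (M.braidedMul ((LinearMap.ker q.toLinearMap).subtype.lTensor _ y') X) = 0 := by
    induction y' using TensorProduct.induction_on with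
    | zero => simp
    | add x y hx hy => rw [map_add, map_add, LinearMap.add_apply, map_add, hx, hy, add_zero]
    | tmul x y =>
      rw [LinearMap.lTensor_tmul, braidedMul_tmul, Module.End.mul_apply]
      refine map_map_apply_eq_zero (q := q.toLinearMap) hq (fun t ht => ?_) (fun t ht => ht) ?_
      · have ht : q t = 0 := ht
        simp [ht]
      · obtain ⟨w, hw⟩ := (mem_range_lTensor_iff (q := q.toLinearMap) hq rfl _).2 (hcoact y y.2)
        rw [Submodule.subtype_apply, ← hw]
        clear hw
        induction w using TensorProduct.induction_on with
        | zero => simp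
        | add x y hx hy => rw [map_add, map_add, LinearMap.add_apply, map_add, hx, hy, add_zero]
        | tmul a y =>
          induction a using MonoidAlgebra.induction_linear with
          | zero => simp
          | add a b ha hb =>
            rw [TensorProduct.add_tmul, map_add, map_add, LinearMap.add_apply, map_add, ha, hb,
              add_zero]
          | single γ c =>
            rw [LinearMap.lTensor_tmul, single_tmul_eq, tActMul_single_eq_map,
              ← LinearMap.comp_apply,
              ← TensorProduct.map_comp, Submodule.subtype_apply, h0 (c • y) ?_,
              TensorProduct.map_zero_right, LinearMap.zero_apply]
            have : q y = 0 := y.2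
            rw [map_smul, this, smul_zero]
  rw [h1, h2, add_zero]

end Quotient

/-! ### Adjoining a primitive element to the defining ideal. -/

theorem tProj_mul_eq_zero (M : YDModule k Γ V) (a : TensorAlgebra k V) {s : TensorAlgebra k V}
    (hs : ∀ n < 2, M.tProj n s = 0) : ∀ n < 2, M.tProj n (a * s) = 0 := by
  induction a using TensorAlgebra.induction generalizing s with
  | algebraMap c => intro n hn; rw [← Algebra.smul_def, map_smul, hs n hn, smul_zero]
  | ι v =>
    intro n hn
    cases n with
    | zero => exact M.tProj_ι_mul_zero v s
    | succ n => rw [tProj_ι_mul_succ, hs n (by omega), mul_zero]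
  | mul a b ha hb => rw [mul_assoc]; exact ha (hb hs)
  | add a b ha hb => intro n hn; rw [add_mul, map_add, ha hs n hn, hb hs n hn, add_zero]

/-- The left ideal of `T(V)` that is generated by the defining ideal of the Nichols algebra and the
products `t b`. -/
def extIdeal (M : YDModule k Γ V) (t : TensorAlgebra k V) : Ideal (TensorAlgebra k V) :=
  M.nicholsIdeal ⊔ Ideal.span {s | ∃ b, SetLike.IsHomogeneousElem M.tGrading b ∧ s = t * b}

theorem nicholsIdeal_le_extIdeal (M : YDModule k Γ V) (t : TensorAlgebra k V) :
    M.nicholsIdeal ≤ M.extIdeal t :=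
  le_sup_left

/-- Every `b` is a sum of homogeneous elements, so restricting the generators to homogeneous `b`
loses nothing; the restriction is what makes the generators homogeneous when `t` is. -/
theorem mul_mem_extIdeal (M : YDModule k Γ V) (t b : TensorAlgebra k V) :
    t * b ∈ M.extIdeal t := by
  classical
  rw [← DirectSum.sum_support_decompose M.tGrading b, Finset.mul_sum]
  refine Ideal.sum_mem _ fun i _ => ?_
  exact Ideal.mem_sup_right (Ideal.subset_span ⟨_, ⟨i, SetLike.coe_mem _⟩, rfl⟩)

theorem self_mem_extIdeal (M : YDModule k Γ V) (t : TensorAlgebra k V) : t ∈ M.extIdeal t := by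
  simpa using M.mul_mem_extIdeal t 1

theorem extIdeal_le (M : YDModule k Γ V) {t : TensorAlgebra k V} {P : Ideal (TensorAlgebra k V)}
    (hI : M.nicholsIdeal ≤ P) (ht : ∀ b, t * b ∈ P) : M.extIdeal t ≤ P :=
  sup_le hI (Ideal.span_le.2 (by rintro s ⟨b, -, rfl⟩; exact ht b))

/-- The elements `s` with `s c` in the ideal form a left ideal that contains the generators, because
these are closed under right multiplication modulo `mul_mem_extIdeal`. -/
instance (M : YDModule k Γ V) (t : TensorAlgebra k V) : (M.extIdeal t).IsTwoSided where
  mul_mem_of_left {a} c ha := by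
    refine M.extIdeal_le (t := t) (P := Submodule.comap
      (LinearMap.toSpanSingleton (TensorAlgebra k V) (TensorAlgebra k V) c) (M.extIdeal t))
      (fun s hs => ?_) (fun b => ?_) ha
    · exact M.nicholsIdeal_le_extIdeal t (Ideal.mul_mem_right _ _ hs)
    · have : t * b * c ∈ M.extIdeal t := by
        rw [mul_assoc]; exact M.mul_mem_extIdeal t _
      exact this

/-- Each condition is checked on the defining ideal, where it is known, and on the products `t b`.
For the latter, the action, the coaction and `Δ` send `t` into the required kernel by the hypotheses
on its class in `𝔅(V)`, and multiplication by `b` stays there. The degree condition holds because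
`t` has degree at least two. -/
theorem isHopfIdeal_extIdeal (M : YDModule k Γ V) {t : TensorAlgebra k V} {n : ℕ} (hn : 2 ≤ n)
    (ht : t ∈ M.tGrading n)
    (hact : ∀ γ : Γ, ∃ c : k, γ • NicholsAlgebra.mk M t = c • NicholsAlgebra.mk M t)
    (hcoact : ∃ g : Γ, NicholsAlgebra.coact M (NicholsAlgebra.mk M t) =
      MonoidAlgebra.single g 1 ⊗ₜ NicholsAlgebra.mk M t)
    (hcomul : NicholsAlgebra.comul M (NicholsAlgebra.mk M t) =
      NicholsAlgebra.mk M t ⊗ₜ 1 + 1 ⊗ₜ NicholsAlgebra.mk M t) :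
    M.IsHopfIdeal (M.extIdeal t) := by
  let q : TensorAlgebra k V →ₐ[k] TensorAlgebra k V ⧸ M.extIdeal t :=
    Ideal.Quotient.mkₐ k (M.extIdeal t)
  have hq : Function.Surjective q := Ideal.Quotient.mkₐ_surjective k _
  have hq0 : ∀ s, q s = 0 ↔ s ∈ M.extIdeal t := fun s => Ideal.Quotient.eq_zero_iff_mem
  have hker : LinearMap.ker q.toLinearMap = (M.extIdeal t).restrictScalars k :=
    Submodule.ext hq0
  have hqt : q t = 0 := (hq0 t).2 (M.self_mem_extIdeal t)
  let f : M.NicholsAlgebra →ₐ[k] TensorAlgebra k V ⧸ M.extIdeal t :=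
    NicholsAlgebra.lift M q fun s hs => (hq0 s).2 (M.nicholsIdeal_le_extIdeal t hs)
  have hf : ∀ s, f (NicholsAlgebra.mk M s) = q s := fun s => rfl
  have hqf : q.toLinearMap = f.toLinearMap ∘ₗ (NicholsAlgebra.mk M).toLinearMap := rfl
  have hI := M.isHopfIdeal_nicholsIdeal
  have act_mem : ∀ γ : Γ, ∀ s ∈ M.extIdeal t, M.tAct γ s ∈ M.extIdeal t := by
    intro γ
    refine M.extIdeal_le (P := (M.extIdeal t).comap (M.tAct γ)) (fun s hs => ?_) (fun b => ?_)
    · exact M.nicholsIdeal_le_extIdeal t (hI.act_mem γ s hs)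
    · rw [Ideal.mem_comap, map_mul]
      refine Ideal.mul_mem_right _ _ ?_
      obtain ⟨c, hc⟩ := hact γ
      rw [NicholsAlgebra.smul_mk] at hc
      rw [← hq0, ← hf, hc, map_smul, hf, hqt, smul_zero]
  have hq_act : ∀ γ s, q s = 0 → q (M.tAct γ s) = 0 := fun γ s hs =>
    (hq0 _).2 (act_mem γ s ((hq0 s).1 hs))
  have coact_ker : ∀ s ∈ M.extIdeal t,
      q.toLinearMap.lTensor (MonoidAlgebra k Γ) (M.tCoact s) = 0 := by
    let F : TensorAlgebra k V →ₐ[k] MonoidAlgebra k Γ ⊗[k] (TensorAlgebra k V ⧸ M.extIdeal t) :=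
      (Algebra.TensorProduct.map (AlgHom.id k _) f).comp
        ((NicholsAlgebra.coact M).comp (NicholsAlgebra.mk M))
    have hF : ∀ s, q.toLinearMap.lTensor (MonoidAlgebra k Γ) (M.tCoact s) = F s := by
      intro s
      rw [hqf, LinearMap.lTensor_comp]
      rfl
    intro s hs
    rw [hF]
    refine M.extIdeal_le (P := RingHom.ker F) (fun s hs => ?_) (fun b => ?_) hs
    · rw [RingHom.mem_ker, AlgHom.comp_apply, AlgHom.comp_apply,
        (NicholsAlgebra.mk_eq_zero M s).2 hs,
        map_zero, map_zero]
    · rw [RingHom.mem_ker, map_mul]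
      obtain ⟨g, hg⟩ := hcoact
      have : F t = 0 := by
        rw [AlgHom.comp_apply, AlgHom.comp_apply, hg, Algebra.TensorProduct.map_tmul, hf, hqt,
          TensorProduct.tmul_zero]
      rw [this, zero_mul]
  have hq_coact : ∀ s, q s = 0 → q.toLinearMap.lTensor (MonoidAlgebra k Γ) (M.tCoact s) = 0 :=
    fun s hs => coact_ker s ((hq0 s).1 hs)
  refine ⟨inferInstance, ?_, ?_, act_mem, ?_, ?_⟩
  · refine hI.isHomogeneous.sup (Ideal.homogeneous_span _ _ ?_)
    rintro _ ⟨b, ⟨i, hb⟩, rfl⟩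
    exact ⟨n + i, SetLike.GradedMul.mul_mem ht hb⟩
  · let P : Ideal (TensorAlgebra k V) :=
      { carrier := {s | ∀ n < 2, M.tProj n s = 0}
        add_mem' := fun ha hb n hn => by rw [map_add, ha n hn, hb n hn, add_zero]
        zero_mem' := fun n _ => map_zero _
        smul_mem' := fun a _ hs => M.tProj_mul_eq_zero a hs }
    have : M.extIdeal t ≤ P := by
      refine sup_le (fun s hs => hI.proj_eq_zero s hs) (Ideal.span_le.2 ?_)
      rintro _ ⟨b, ⟨i, hb⟩, rfl⟩ m hm
      exact M.tProj_of_mem_ne (by omega) (SetLike.GradedMul.mul_mem ht hb)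
    exact fun s hs => this hs
  · intro s hs
    rw [mem_range_lTensor_iff (q := q.toLinearMap) hq hker]
    exact coact_ker s hs
  · intro s hs
    rw [mem_range_rTensor_sup_range_lTensor_iff (q := q.toLinearMap) hq hker]
    -- The elements satisfying the coideal condition form a left ideal by `braidedMul_mem_ker`, so
    -- it is enough to test generators.
    let P : Ideal (TensorAlgebra k V) :=
      { carrier := {s | TensorProduct.map q.toLinearMap q.toLinearMap (M.tComul s) = 0}
        add_mem' := fun {a b} ha hb => by
          have ha : TensorProduct.map q.toLinearMap q.toLinearMap (M.tComul a) = 0 := ha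
          have hb : TensorProduct.map q.toLinearMap q.toLinearMap (M.tComul b) = 0 := hb
          change TensorProduct.map q.toLinearMap q.toLinearMap (M.tComul (a + b)) = 0
          rw [map_add, map_add, ha, hb, add_zero]
        zero_mem' := by
          change TensorProduct.map q.toLinearMap q.toLinearMap (M.tComul 0) = 0
          rw [map_zero, map_zero]
        smul_mem' := fun a s hs => by
          change TensorProduct.map q.toLinearMap q.toLinearMap (M.tComul (a * s)) = 0
          rw [tComul_mul]
          exact braidedMul_mem_ker hq hq_act _ hs }
    have hP : ∀ s, TensorProduct.map q.toLinearMap q.toLinearMap (M.tComul s) =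
        TensorProduct.map f.toLinearMap f.toLinearMap
          (NicholsAlgebra.comul M (NicholsAlgebra.mk M s)) := by
      intro s
      rw [NicholsAlgebra.comul_mk, hqf, TensorProduct.map_comp, LinearMap.comp_apply]
    refine M.extIdeal_le (P := P) (fun s hs => ?_) (fun b => ?_) hs
    · change TensorProduct.map q.toLinearMap q.toLinearMap (M.tComul s) = 0
      rw [hP, (NicholsAlgebra.mk_eq_zero M s).2 hs, map_zero, map_zero]
    · change TensorProduct.map q.toLinearMap q.toLinearMap (M.tComul (t * b)) = 0
      rw [tComul_mul]
      -- Since `Δ (t b) = Δ t Δ b` and the kernel is a right ideal, only `Δ t` has to be killed;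
      -- modulo the defining ideal it is `t ⊗ 1 + 1 ⊗ t`.
      refine braidedMul_mem_ker' hq hq_coact _ ?_
      rw [hP, hcomul, map_add, TensorProduct.map_tmul, TensorProduct.map_tmul,
        AlgHom.toLinearMap_apply, hf, hqt, TensorProduct.zero_tmul, TensorProduct.tmul_zero,
        add_zero]

namespace NicholsAlgebra

variable (M : YDModule k Γ V)

/-- A homogeneous element of degree at least two that modulo the defining ideal is a primitive
homogeneous eigenvector lies in the defining ideal of the Nichols algebra. -/
theorem eq_zero_of_primitive {t : TensorAlgebra k V} {n : ℕ} (hn : 2 ≤ n)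
    (ht : t ∈ M.tGrading n) (hact : ∀ γ : Γ, ∃ c : k, γ • mk M t = c • mk M t)
    (hcoact : ∃ g : Γ, coact M (mk M t) = MonoidAlgebra.single g 1 ⊗ₜ mk M t)
    (hcomul : comul M (mk M t) = mk M t ⊗ₜ 1 + 1 ⊗ₜ mk M t) : mk M t = 0 :=
  (mk_eq_zero M t).2 ((M.isHopfIdeal_extIdeal hn ht hact hcoact hcomul).le
    (M.self_mem_extIdeal t))

/-- Compare bidegrees `(i, j)`. If `i + j = n`, gradedness of `Δ` allows the component to be
replaced by `r` itself; otherwise both sides vanish, since `1` lives in degree zero. -/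
theorem comul_proj_of_primitive {r : M.NicholsAlgebra}
    (hr : comul M r = r ⊗ₜ 1 + 1 ⊗ₜ r) (n : ℕ) :
    comul M (proj M n r) = proj M n r ⊗ₜ 1 + 1 ⊗ₜ proj M n r := by
  refine tensor_ext M fun i j => ?_
  simp only [map_add, TensorProduct.map_tmul]
  by_cases h : i + j = n
  · subst h
    rw [← map_proj_comul, hr]
    simp only [map_add, TensorProduct.map_tmul]
    congr 1
    · by_cases hj : j = 0
      · subst hj; rw [add_zero, proj_proj_same]
      · rw [proj_one_of_ne M hj, TensorProduct.tmul_zero, TensorProduct.tmul_zero]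
    · by_cases hi : i = 0
      · subst hi; rw [zero_add, proj_proj_same]
      · rw [proj_one_of_ne M hi, TensorProduct.zero_tmul, TensorProduct.zero_tmul]
  · rw [map_proj_comul_proj_ne M h]
    by_cases hi : i = n
    · subst hi
      rw [proj_one_of_ne M (n := j) (by omega), TensorProduct.tmul_zero, zero_add]
      by_cases hi : i = 0
      · subst hi
        rw [proj_proj_ne M (by omega), TensorProduct.tmul_zero]
      · rw [proj_one_of_ne M hi, TensorProduct.zero_tmul]
    · rw [proj_proj_ne M (Ne.symm hi), TensorProduct.zero_tmul, zero_add]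
      by_cases hj : j = n
      · subst hj
        rw [proj_one_of_ne M (n := i) (by omega), TensorProduct.zero_tmul]
      · rw [proj_proj_ne M (Ne.symm hj), TensorProduct.tmul_zero]

/-- The primitive homogeneous eigenvectors in `𝔅(V)` are the elements of `V`. -/
theorem exists_eq_ι_of_primitive {r : M.NicholsAlgebra}
    (hact : ∀ γ : Γ, ∃ c : k, γ • r = c • r)
    (hcoact : ∃ g : Γ, coact M r = MonoidAlgebra.single g 1 ⊗ₜ r)
    (hcomul : comul M r = r ⊗ₜ 1 + 1 ⊗ₜ r) (hcounit : counit M r = 0) : ∃ v, r = ι M v := by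
  have h0 : proj M 0 r = 0 := by rw [proj_zero, hcounit, map_zero]
  -- The projections commute with the action, the coaction and `Δ`, so each component is again a
  -- primitive homogeneous eigenvector, to which maximality of the defining ideal applies.
  have h2 : ∀ n, 2 ≤ n → proj M n r = 0 := by
    intro n hn
    obtain ⟨t, rfl⟩ := mk_surjective M r
    refine eq_zero_of_primitive M hn (M.tProj_mem n t) (fun γ => ?_) ?_
      (comul_proj_of_primitive M hcomul n)
    · obtain ⟨c, hc⟩ := hact γ
      exact ⟨c, by rw [← proj_mk, smul_proj, hc, map_smul]⟩
    · obtain ⟨g, hg⟩ := hcoact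
      exact ⟨g, by rw [← proj_mk, coact_proj, hg, LinearMap.lTensor_tmul]⟩
  obtain ⟨v, hv⟩ := proj_one_eq_ι M r
  refine ⟨v, ?_⟩
  obtain ⟨n, hn, hn2⟩ := ((eventually_sum_proj M r).and (Filter.eventually_ge_atTop 2)).exists
  rw [← hv, ← hn.symm.trans (Finset.sum_eq_single 1 ?_ ?_)]
  · intro m _ hm
    obtain rfl | hm : m = 0 ∨ 2 ≤ m := by omega
    · exact h0
    · exact h2 m hm
  · intro h; exact absurd (Finset.mem_range.2 (by omega)) h

end NicholsAlgebra

namespace Bosonization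

variable (M : YDModule k Γ V)

/-! ### Coefficients of elements of the bosonization -/

/-- The coefficient of `γ`, as a linear map `𝔅(V) # kΓ → 𝔅(V)`. -/
def coeffL (γ : Γ) : M.Bosonization →ₗ[k] M.NicholsAlgebra :=
  Finsupp.lapply γ ∘ₗ (SkewMonoidAlgebra.coeffLinearEquiv (S := k)).toLinearMap

theorem coeffL_apply (γ : Γ) (a : M.Bosonization) : coeffL M γ a = a.coeff γ :=
  rfl

theorem coeffL_single_same (γ : Γ) (r : M.NicholsAlgebra) :
    coeffL M γ (SkewMonoidAlgebra.single γ r) = r := by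
  classical
  rw [coeffL_apply, SkewMonoidAlgebra.coeff_single_apply, if_pos rfl]

theorem coeffL_single_ne {γ γ' : Γ} (h : γ' ≠ γ) (r : M.NicholsAlgebra) :
    coeffL M γ (SkewMonoidAlgebra.single γ' r) = 0 := by
  classical
  rw [coeffL_apply, SkewMonoidAlgebra.coeff_single_apply, if_neg h]

/-- The sum of the coefficients, that is, the map `id # ε : 𝔅(V) # kΓ → 𝔅(V)`. -/
def total : M.Bosonization →ₗ[k] M.NicholsAlgebra :=
  Finsupp.lsum k (fun _ => LinearMap.id) ∘ₗ
    (SkewMonoidAlgebra.coeffLinearEquiv (S := k)).toLinearMap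

theorem total_single (γ : Γ) (r : M.NicholsAlgebra) :
    total M (SkewMonoidAlgebra.single γ r) = r := by
  have : SkewMonoidAlgebra.coeffLinearEquiv (S := k) (SkewMonoidAlgebra.single γ r) =
      Finsupp.single γ r := rfl
  rw [total, LinearMap.comp_apply, LinearEquiv.coe_coe, this]
  simp

/-- The projection `ε # id : 𝔅(V) # kΓ → kΓ`. -/
def toGroupAlgebra : M.Bosonization →ₗ[k] MonoidAlgebra k Γ :=
  Finsupp.lsum k (fun γ => (NicholsAlgebra.counit M).toLinearMap.smulRight
    (MonoidAlgebra.single γ (1 : k))) ∘ₗ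
    (SkewMonoidAlgebra.coeffLinearEquiv (S := k)).toLinearMap

theorem toGroupAlgebra_single (γ : Γ) (r : M.NicholsAlgebra) :
    toGroupAlgebra M (SkewMonoidAlgebra.single γ r) =
      NicholsAlgebra.counit M r • MonoidAlgebra.single γ (1 : k) := by
  have : SkewMonoidAlgebra.coeffLinearEquiv (S := k) (SkewMonoidAlgebra.single γ r) =
      Finsupp.single γ r := rfl
  rw [toGroupAlgebra, LinearMap.comp_apply, LinearEquiv.coe_coe, this]
  simp

/-- A linear map on the image of `comulAux` is determined by the values on `(a # h γ) ⊗ (s # γ)`. -/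
theorem apply_comulAux {W : Type*} [AddCommGroup W] [Module k W] (γ : Γ) (a b : M.NicholsAlgebra)
    (F : M.Bosonization ⊗[k] M.Bosonization →ₗ[k] W)
    (G : MonoidAlgebra k Γ ⊗[k] M.NicholsAlgebra →ₗ[k] W)
    (h : ∀ γ' s, F (SkewMonoidAlgebra.single (γ' * γ) a ⊗ₜ SkewMonoidAlgebra.single γ s) =
      G (MonoidAlgebra.single γ' 1 ⊗ₜ s)) :
    F (comulAux M γ (a ⊗ₜ b)) = G (NicholsAlgebra.coact M b) := by
  rw [comulAux_tmul]
  generalize NicholsAlgebra.coact M b = z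
  induction z using TensorProduct.induction_on with
  | zero => simp
  | add x y hx hy => rw [map_add, mul_add, add_mul, map_add, map_add, hx, hy]
  | tmul c s =>
    induction c using MonoidAlgebra.induction_linear with
    | zero => simp
    | add c d hc hd =>
      rw [TensorProduct.add_tmul, map_add, mul_add, add_mul, map_add, map_add, hc, hd]
    | single γ' c =>
      rw [single_tmul_eq, ← h, incl, Algebra.TensorProduct.map_tmul, ofGroupAlgebra_single,
        Algebra.TensorProduct.tmul_mul_tmul, Algebra.TensorProduct.tmul_mul_tmul, one_mul,
        ofNichols_mul_ofGroup, ofNichols_mul_ofGroup, ofGroup_apply, single_mul_single, smul_one,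
        mul_one]

theorem counit_coact (b : M.NicholsAlgebra) :
    TensorProduct.lid k _ ((Coalgebra.counit (R := k) (A := MonoidAlgebra k Γ)).rTensor _
      (NicholsAlgebra.coact M b)) = b := by
  have : ((Algebra.TensorProduct.lid k M.NicholsAlgebra).toAlgHom.comp
      (Algebra.TensorProduct.map (Bialgebra.counitAlgHom k (MonoidAlgebra k Γ))
        (AlgHom.id k M.NicholsAlgebra))).comp (NicholsAlgebra.coact M) = AlgHom.id k _ := by
    refine algHom_ext_homogeneous M fun g v hv => ?_
    simp [NicholsAlgebra.coact_ι, hv]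
  exact DFunLike.congr_fun this b

/-- In `Δ(r # γ')` every second tensor factor carries the group element `γ'`, so `coeffL` selects
one coefficient, while `total` erases the coaction terms on the left. This transfers equations for
`Δ y` to each coefficient of `y`. -/
theorem map_total_coeffL_comul (γ : Γ) (y : M.Bosonization) :
    TensorProduct.map (total M) (coeffL M γ) (Coalgebra.comul (R := k) y) =
      NicholsAlgebra.comul M (coeffL M γ y) := by
  induction y using SkewMonoidAlgebra.induction_on with
  | zero => simp
  | add x y hx hy => simp only [map_add, hx, hy]
  | single γ' r =>
    rw [comul_single]
    by_cases h : γ' = γ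
    · subst h
      rw [coeffL_single_same]
      generalize NicholsAlgebra.comul M r = z
      induction z using TensorProduct.induction_on with
      | zero => simp
      | add x y hx hy => simp only [map_add, hx, hy]
      | tmul a b =>
        rw [apply_comulAux M γ' a b _ (TensorProduct.mk k _ _ a ∘ₗ
          (TensorProduct.lid k _).toLinearMap ∘ₗ
            (Coalgebra.counit (R := k) (A := MonoidAlgebra k Γ)).rTensor _)]
        · simp only [LinearMap.comp_apply, LinearEquiv.coe_coe, counit_coact]
          rfl
        · intro δ s
          simp [total_single, coeffL_single_same]
    · rw [coeffL_single_ne M h, map_zero]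
      generalize NicholsAlgebra.comul M r = z
      induction z using TensorProduct.induction_on with
      | zero => simp
      | add x y hx hy => simp only [map_add, hx, hy, add_zero]
      | tmul a b =>
        rw [apply_comulAux M γ' a b _ 0]
        · simp
        · intro δ s
          simp [coeffL_single_ne M h]

/-- The map `id # ε` is comultiplicative; in particular it sends group-like elements to group-like
elements of `𝔅(V)`. -/
theorem map_total_total_comul (y : M.Bosonization) :
    TensorProduct.map (total M) (total M) (Coalgebra.comul (R := k) y) =
      NicholsAlgebra.comul M (total M y) := by
  induction y using SkewMonoidAlgebra.induction_on with
  | zero => simp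
  | add x y hx hy => simp only [map_add, hx, hy]
  | single γ r =>
    rw [comul_single, total_single]
    generalize NicholsAlgebra.comul M r = z
    induction z using TensorProduct.induction_on with
    | zero => simp
    | add x y hx hy => simp only [map_add, hx, hy]
    | tmul a b =>
      rw [apply_comulAux M γ a b _ (TensorProduct.mk k _ _ a ∘ₗ
        (TensorProduct.lid k _).toLinearMap ∘ₗ
          (Coalgebra.counit (R := k) (A := MonoidAlgebra k Γ)).rTensor _)]
      · simp only [LinearMap.comp_apply, LinearEquiv.coe_coe, counit_coact]
        rfl
      · intro δ s
        simp [total_single]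

theorem counit_total (y : M.Bosonization) :
    NicholsAlgebra.counit M (total M y) = Coalgebra.counit (R := k) y := by
  induction y using SkewMonoidAlgebra.induction_on with
  | zero => simp
  | add x y hx hy => simp only [map_add, hx, hy]
  | single γ r => rw [total_single, counit_single]

theorem counit_total_comp :
    (NicholsAlgebra.counit M).toLinearMap ∘ₗ total M =
      Coalgebra.counit (R := k) (A := M.Bosonization) :=
  LinearMap.ext (counit_total M)

end Bosonization

/-! ### Counit laws and group-like elements of the Nichols algebra. -/

namespace NicholsAlgebra

open Bosonization

variable (M : YDModule k Γ V)

/-- The counit laws of `𝔅(V)` are inherited from the bosonization, whose coalgebra axioms are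
already known, by applying `total` and `coeffL`. -/
theorem rTensor_counit_comul (r : M.NicholsAlgebra) :
    (counit M).toLinearMap.rTensor _ (comul M r) = 1 ⊗ₜ r := by
  have h := map_total_coeffL_comul M 1 (SkewMonoidAlgebra.single 1 r)
  rw [coeffL_single_same] at h
  rw [← h, LinearMap.rTensor, ← LinearMap.comp_apply, ← TensorProduct.map_comp,
    counit_total_comp, LinearMap.id_comp, ← LinearMap.comp_id (Coalgebra.counit),
    ← LinearMap.id_comp (Coalgebra.counit)]
  have h' := congrArg ((coeffL M 1).lTensor k)
    (Coalgebra.rTensor_counit_comul (R := k) (SkewMonoidAlgebra.single 1 r : M.Bosonization))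
  rw [LinearMap.lTensor_tmul, coeffL_single_same, ← LinearMap.comp_apply,
    LinearMap.lTensor_comp_rTensor] at h'
  exact h'

theorem lTensor_counit_comul (r : M.NicholsAlgebra) :
    (counit M).toLinearMap.lTensor _ (comul M r) = r ⊗ₜ 1 := by
  have h := map_total_total_comul M (SkewMonoidAlgebra.single 1 r)
  rw [total_single] at h
  rw [← h, LinearMap.lTensor, ← LinearMap.comp_apply, ← TensorProduct.map_comp,
    counit_total_comp, LinearMap.id_comp]
  have h' := congrArg ((total M).rTensor k)
    (Coalgebra.lTensor_counit_comul (R := k) (SkewMonoidAlgebra.single 1 r : M.Bosonization))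
  rw [LinearMap.rTensor_tmul, total_single, ← LinearMap.comp_apply,
    LinearMap.rTensor_comp_lTensor] at h'
  exact h'

theorem eq_algebraMap_of_comul {r : M.NicholsAlgebra} (hr : comul M r = 1 ⊗ₜ r) :
    r = algebraMap k _ (counit M r) := by
  have h := lTensor_counit_comul M r
  rw [hr, LinearMap.lTensor_tmul] at h
  have h' := congrArg (TensorProduct.rid k _) h
  rw [TensorProduct.rid_tmul, TensorProduct.rid_tmul, one_smul] at h'
  rw [Algebra.algebraMap_eq_smul_one]
  exact h'.symm

theorem counit_smul (γ : Γ) (r : M.NicholsAlgebra) : counit M (γ • r) = counit M r := by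
  have : (counit M).comp (act M γ) = counit M := by
    refine algHom_ext fun v => ?_
    have h : act M γ (ι M v) = ι M (M.act γ v) := smul_ι M γ v
    rw [AlgHom.comp_apply, h, counit_ι, counit_ι]
  exact DFunLike.congr_fun this r

/-- The only group-like element of `𝔅(V)` is `1`. -/
theorem eq_one_of_comul_eq_tmul_self {s : M.NicholsAlgebra} (hs : comul M s = s ⊗ₜ s)
    (hε : counit M s = 1) : s = 1 := by
  -- The component of `s ⊗ s` in bidegree `(n, n)` is the tensor square of the degree `n` part,
  -- which is nonzero over a field; by gradedness it comes from the degree `n + n` part of `s`. A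
  -- nonzero part of positive degree would thus produce nonzero parts of arbitrarily large degree.
  have step : ∀ n, proj M n s ≠ 0 → proj M (n + n) s ≠ 0 := by
    intro n hn h
    have h' := map_proj_comul M n n s
    rw [h, map_zero, map_zero, hs, TensorProduct.map_tmul] at h'
    obtain ⟨f, hf⟩ := Module.Projective.exists_dual_ne_zero k hn
    have h'' := congrArg (fun z => TensorProduct.lid k k (TensorProduct.map f f z)) h'
    simp [hf] at h''
  have h0 : ∀ n, n ≠ 0 → proj M n s = 0 := by
    intro n hn
    by_contra h
    have hm : ∀ m, ∃ l, m ≤ l ∧ proj M l s ≠ 0 := by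
      intro m
      induction m with
      | zero => exact ⟨n, Nat.zero_le n, h⟩
      | succ m ih =>
        obtain ⟨l, hl, hl'⟩ := ih
        -- Doubling makes no progress from degree zero, so in that case the degree `n ≠ 0` is used
        -- instead.
        rcases Nat.eq_zero_or_pos l with rfl | hpos
        · exact ⟨n, by omega, h⟩
        · exact ⟨l + l, by omega, step l hl'⟩
    obtain ⟨N, hN⟩ := (eventually_sum_proj M s).exists
    obtain ⟨l, hl, hl'⟩ := hm N
    apply hl'
    rw [← hN, map_sum]
    refine Finset.sum_eq_zero fun i hi => proj_proj_ne M ?_ s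
    have := Finset.mem_range.1 hi
    omega
  obtain ⟨n, hn, hn1⟩ := ((eventually_sum_proj M s).and (Filter.eventually_ge_atTop 1)).exists
  rw [Finset.sum_eq_single 0 (fun i _ hi => h0 i hi)
    (fun h => absurd (Finset.mem_range.2 (by omega)) h), proj_zero, hε, map_one] at hn
  exact hn.symm

end NicholsAlgebra

/-! ### Group-like and skew primitive elements of the bosonization. -/

namespace Bosonization

variable (M : YDModule k Γ V)

/-- Applying `ε # id` on the left of `Δ(r # 1) = (r₁ # (r₂)₋₁) ⊗ ((r₂)₀ # 1)` leaves only the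
coaction. It is used to read off the degree of a skew primitive element. -/
theorem map_toGroupAlgebra_coeffL_comul (r : M.NicholsAlgebra) :
    TensorProduct.map (toGroupAlgebra M) (coeffL M 1)
      (Coalgebra.comul (R := k) (SkewMonoidAlgebra.single 1 r : M.Bosonization)) =
      NicholsAlgebra.coact M r := by
  have h : ∀ z, TensorProduct.map (toGroupAlgebra M) (coeffL M 1) (comulAux M 1 z) =
      NicholsAlgebra.coact M (TensorProduct.lid k _
        ((NicholsAlgebra.counit M).toLinearMap.rTensor _ z)) := by
    intro z
    induction z using TensorProduct.induction_on with
    | zero => simp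
    | add x y hx hy => simp only [map_add, hx, hy]
    | tmul a b =>
      rw [apply_comulAux M 1 a b _ (NicholsAlgebra.counit M a • LinearMap.id)]
      · simp
      · intro γ s
        rw [mul_one, TensorProduct.map_tmul, toGroupAlgebra_single, coeffL_single_same,
          ← TensorProduct.smul_tmul']
        rfl
  rw [comul_single, h, NicholsAlgebra.rTensor_counit_comul, TensorProduct.lid_tmul, one_smul]

instance : Nontrivial M.NicholsAlgebra := (NicholsAlgebra.counit M).toRingHom.domain_nontrivial

theorem ofGroup_injective : Function.Injective (ofGroup M) := by
  intro γ γ' h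
  exact (SkewMonoidAlgebra.single_left_inj one_ne_zero).1 h

theorem isGroupLikeElem_ofGroup (γ : Γ) : IsGroupLikeElem k (ofGroup M γ) where
  counit_eq_one := counitHom_ofGroup M γ
  comul_eq_tmul_self := comulHom_ofGroup M γ

/-- The group-like elements of the bosonization are the elements of `Γ`. -/
theorem exists_eq_ofGroup {u : M.Bosonization} (hu : IsGroupLikeElem k u) :
    ∃ γ, u = ofGroup M γ := by
  have hs : total M u = 1 := by
    refine NicholsAlgebra.eq_one_of_comul_eq_tmul_self M ?_ ?_
    · rw [← map_total_total_comul, hu.comul_eq_tmul_self, TensorProduct.map_tmul]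
    · rw [counit_total, hu.counit_eq_one]
  -- With `total M u = 1`, each coefficient `r` satisfies `Δ r = 1 ⊗ r` and is therefore a scalar,
  -- so `u` lies in the span of `Γ`. Linear independence of group-like elements then forces `u` into
  -- `Γ`.
  have hc : ∀ γ, u.coeff γ = NicholsAlgebra.counit M (u.coeff γ) • 1 := by
    intro γ
    rw [← Algebra.algebraMap_eq_smul_one]
    refine NicholsAlgebra.eq_algebraMap_of_comul M ?_
    rw [← coeffL_apply, ← map_total_coeffL_comul, hu.comul_eq_tmul_self, TensorProduct.map_tmul,
      hs]
  by_contra! h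
  have hind : LinearIndepOn k id (insert u (Set.range (ofGroup M))) :=
    linearIndepOn_isGroupLikeElem.mono (by
      rintro _ (rfl | ⟨γ, rfl⟩)
      · exact hu
      · exact isGroupLikeElem_ofGroup M γ)
  have hnot : u ∉ Submodule.span k (Set.range (ofGroup M)) := by
    simpa using hind.notMem_span_of_insert (by rintro ⟨γ, hγ⟩; exact h γ hγ.symm)
  apply hnot
  rw [← SkewMonoidAlgebra.sum_single u, SkewMonoidAlgebra.sum_def]
  refine Submodule.sum_mem _ fun γ _ => ?_
  rw [hc γ, ← SkewMonoidAlgebra.smul_single]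
  exact Submodule.smul_mem _ _ (Submodule.subset_span ⟨γ, rfl⟩)

/-- The skew primitive elements of the bosonization on which `Γ` acts by a nontrivial character
lie in `V`. -/
theorem exists_eq_ι_of_skewPrimitive {y : M.Bosonization} {g : Γ} {χ : Γ →* kˣ} (hχ : χ ≠ 1)
    (hy : Coalgebra.comul (R := k) y = y ⊗ₜ 1 + ofGroup M g ⊗ₜ y)
    (hact : ∀ γ, ofGroup M γ * y = (χ γ : k) • (y * ofGroup M γ)) :
    ∃ v : V, y = ofNichols M (NicholsAlgebra.ι M v) ∧
      M.coact v = MonoidAlgebra.single g 1 ⊗ₜ v ∧ ∀ γ, M.act γ v = (χ γ : k) • v := by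
  -- Compare coefficients at `γ z = z γ`; commutativity of `Γ` makes both sides involve the same
  -- coefficient of `y`.
  have hsmul : ∀ γ z, γ • y.coeff z = (χ γ : k) • y.coeff z := by
    intro γ z
    have h := congrArg (fun a => a.coeff (γ * z)) (hact γ)
    simp only [ofGroup_apply, SkewMonoidAlgebra.coeff_smul, Finsupp.smul_apply] at h
    rw [SkewMonoidAlgebra.coeff_single_mul, mul_comm γ z, SkewMonoidAlgebra.coeff_mul_single] at h
    simpa using h
  obtain ⟨γ₀, hγ₀⟩ : ∃ γ, χ γ ≠ 1 := by
    by_contra! h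
    exact hχ (MonoidHom.ext h)
  -- The counit is invariant under `Γ`, so a nonzero value would force `χ γ₀ = 1`. This is what
  -- excludes the trivial skew primitive `1 - g`.
  have hε : ∀ z, NicholsAlgebra.counit M (y.coeff z) = 0 := by
    intro z
    have h := congrArg (NicholsAlgebra.counit M) (hsmul γ₀ z)
    rw [NicholsAlgebra.counit_smul, map_smul, smul_eq_mul] at h
    by_contra h0
    exact hγ₀ (Units.ext (mul_right_cancel₀ h0 (by rw [Units.val_one, one_mul]; exact h.symm)))
  have hΔ : ∀ z, NicholsAlgebra.comul M (y.coeff z) =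
      total M y ⊗ₜ coeffL M z 1 + 1 ⊗ₜ y.coeff z := by
    intro z
    rw [← coeffL_apply, ← map_total_coeffL_comul, hy, map_add, TensorProduct.map_tmul,
      TensorProduct.map_tmul, ofGroup_apply, total_single]
  -- The term `y ⊗ 1` contributes only at `z = 1`; every other coefficient is a scalar of counit
  -- zero.
  have hz : ∀ z, z ≠ 1 → y.coeff z = 0 := by
    intro z hz
    have h := hΔ z
    rw [SkewMonoidAlgebra.one_def, coeffL_single_ne M (Ne.symm hz), TensorProduct.tmul_zero,
      zero_add] at h
    rw [NicholsAlgebra.eq_algebraMap_of_comul M h, hε, map_zero]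
  have hy1 : y = SkewMonoidAlgebra.single 1 (y.coeff 1) := by
    classical
    ext z
    rw [SkewMonoidAlgebra.coeff_single_apply]
    split_ifs with h
    · rw [h]
    · exact hz z (Ne.symm h)
  have hcoact : NicholsAlgebra.coact M (y.coeff 1) = MonoidAlgebra.single g 1 ⊗ₜ y.coeff 1 := by
    rw [← map_toGroupAlgebra_coeffL_comul, ← hy1, hy, map_add, TensorProduct.map_tmul,
      TensorProduct.map_tmul, ofGroup_apply, toGroupAlgebra_single,
      map_one (NicholsAlgebra.counit M), one_smul]
    nth_rewrite 1 [hy1]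
    rw [toGroupAlgebra_single, hε, zero_smul, TensorProduct.zero_tmul, zero_add, coeffL_apply]
  have hcomul : NicholsAlgebra.comul M (y.coeff 1) = y.coeff 1 ⊗ₜ 1 + 1 ⊗ₜ y.coeff 1 := by
    have h := hΔ 1
    nth_rewrite 2 [hy1] at h
    rwa [total_single, SkewMonoidAlgebra.one_def, coeffL_single_same] at h
  obtain ⟨v, hv⟩ := NicholsAlgebra.exists_eq_ι_of_primitive M
    (fun γ => ⟨_, hsmul γ 1⟩) ⟨g, hcoact⟩ hcomul (hε 1)
  refine ⟨v, ?_, ?_, fun γ => ?_⟩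
  · rw [ofNichols_apply, ← hv, ← hy1]
  -- The degree and the character are known in `𝔅(V)` and are pulled back to `V` along the injection
  -- `ι`, which stays injective after tensoring with `kΓ`.
  · apply Module.Flat.lTensor_preserves_injective_linearMap (M := MonoidAlgebra k Γ)
      (NicholsAlgebra.ι M) (NicholsAlgebra.ι_injective M)
    rw [← NicholsAlgebra.coact_ι, ← hv, hcoact, LinearMap.lTensor_tmul, ← hv]
  · apply NicholsAlgebra.ι_injective M
    rw [← NicholsAlgebra.smul_ι, map_smul, ← hv, hsmul]

end Bosonization

/-! ### Automorphisms of Yetter-Drinfeld modules along automorphisms of the group -/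

/-- The linear automorphism `φ` of `V` is compatible with the action and the coaction along the
automorphism `ψ` of `Γ`. -/
structure IsTwistedAut (M : YDModule k Γ V) (φ : V ≃ₗ[k] V) (ψ : Γ ≃* Γ) : Prop where
  map_act : ∀ γ v, φ (M.act γ v) = M.act (ψ γ) (φ v)
  coact_map : ∀ v, M.coact (φ v) =
    TensorProduct.congr (MonoidAlgebra.domCongr k k ψ).toLinearEquiv φ (M.coact v)

namespace IsTwistedAut

variable {M : YDModule k Γ V} {φ : V ≃ₗ[k] V} {ψ : Γ ≃* Γ}

theorem symm (h : M.IsTwistedAut φ ψ) : M.IsTwistedAut φ.symm ψ.symm where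
  map_act γ v := by
    apply φ.injective
    rw [h.map_act, ψ.apply_symm_apply, φ.apply_symm_apply, φ.apply_symm_apply]
  coact_map v := by
    obtain ⟨w, rfl⟩ := φ.surjective v
    rw [h.coact_map, φ.symm_apply_apply]
    exact ((TensorProduct.congr (MonoidAlgebra.domCongr k k ψ).toLinearEquiv φ).symm_apply_apply
      (M.coact w)).symm

theorem coact_homogeneous (h : M.IsTwistedAut φ ψ) {g : Γ} {v : V}
    (hv : M.coact v = MonoidAlgebra.single g 1 ⊗ₜ v) :
    M.coact (φ v) = MonoidAlgebra.single (ψ g) 1 ⊗ₜ φ v := by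
  rw [h.coact_map, hv, TensorProduct.congr_tmul]
  simp

end IsTwistedAut

/-! ### Extending twisted automorphisms to the Nichols algebra and the bosonization. -/

/-- The algebra endomorphism of `T(V)` that is induced by a linear automorphism of `V`. -/
def tMap (φ : V ≃ₗ[k] V) : TensorAlgebra k V →ₐ[k] TensorAlgebra k V :=
  TensorAlgebra.lift k (TensorAlgebra.ι k ∘ₗ φ.toLinearMap)

theorem tMap_ι (φ : V ≃ₗ[k] V) (v : V) :
    tMap φ (TensorAlgebra.ι k v) = TensorAlgebra.ι k (φ v) := by
  simp [tMap]

theorem tMap_symm_tMap (φ : V ≃ₗ[k] V) (t : TensorAlgebra k V) : tMap φ.symm (tMap φ t) = t := by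
  have : (tMap φ.symm).comp (tMap φ) = AlgHom.id k _ := by
    ext v; simp [tMap_ι]
  exact DFunLike.congr_fun this t

theorem tMap_surjective (φ : V ≃ₗ[k] V) : Function.Surjective (tMap φ) :=
  fun t => ⟨tMap φ.symm t, tMap_symm_tMap φ.symm t⟩

namespace IsTwistedAut

variable {M : YDModule k Γ V} {φ : V ≃ₗ[k] V} {ψ : Γ ≃* Γ}

theorem tMap_tAct (h : M.IsTwistedAut φ ψ) (γ : Γ) (t : TensorAlgebra k V) :
    tMap φ (M.tAct γ t) = M.tAct (ψ γ) (tMap φ t) := by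
  have : (tMap φ).comp (M.tAct γ) = (M.tAct (ψ γ)).comp (tMap φ) := by
    ext v; simp [tMap_ι, h.map_act]
  exact DFunLike.congr_fun this t

theorem tCoact_tMap (h : M.IsTwistedAut φ ψ) (t : TensorAlgebra k V) :
    M.tCoact (tMap φ t) = Algebra.TensorProduct.map
      (MonoidAlgebra.domCongr k k ψ : MonoidAlgebra k Γ →ₐ[k] MonoidAlgebra k Γ) (tMap φ)
        (M.tCoact t) := by
  refine LinearMap.congr_fun (f := M.tCoact.toLinearMap ∘ₗ (tMap φ).toLinearMap)
    (g := (Algebra.TensorProduct.map (MonoidAlgebra.domCongr k k ψ :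
      MonoidAlgebra k Γ →ₐ[k] MonoidAlgebra k Γ) (tMap φ)).toLinearMap ∘ₗ
        M.tCoact.toLinearMap) (LinearMap.ext fun t => ?_) t
  refine M.mem_of_homogeneous_mul_mem (LinearMap.eqLocus _ _) ?_ (fun g v hv t ht => ?_) t
  · rw [LinearMap.mem_eqLocus]
    simp only [LinearMap.comp_apply, AlgHom.toLinearMap_apply, map_one]
  · rw [LinearMap.mem_eqLocus] at ht ⊢
    simp only [LinearMap.comp_apply, AlgHom.toLinearMap_apply] at ht ⊢
    rw [map_mul, map_mul, ht, map_mul, map_mul, tMap_ι, tCoact_ι, tCoact_ι, hv,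
      h.coact_homogeneous hv]
    simp [tMap_ι]

theorem tComul_tMap (h : M.IsTwistedAut φ ψ) (t : TensorAlgebra k V) :
    M.tComul (tMap φ t) =
      TensorProduct.map (tMap φ).toLinearMap (tMap φ).toLinearMap (M.tComul t) := by
  refine LinearMap.congr_fun (f := M.tComul ∘ₗ (tMap φ).toLinearMap)
    (g := TensorProduct.map (tMap φ).toLinearMap (tMap φ).toLinearMap ∘ₗ M.tComul)
    (LinearMap.ext fun t => ?_) t
  refine M.mem_of_homogeneous_mul_mem (LinearMap.eqLocus _ _) ?_ (fun g v hv t ht => ?_) t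
  · rw [LinearMap.mem_eqLocus]; simp [tComul_one]
  · rw [LinearMap.mem_eqLocus] at ht ⊢
    simp only [LinearMap.comp_apply, AlgHom.toLinearMap_apply] at ht ⊢
    rw [map_mul, tMap_ι, M.tComul_homogeneous_mul (h.coact_homogeneous hv), ht,
      M.tComul_homogeneous_mul hv]
    generalize M.tComul t = z
    induction z using TensorProduct.induction_on with
    | zero => simp
    | add x y hx hy =>
      simp only [map_add] at hx hy ⊢
      rw [add_add_add_comm, hx, hy, add_add_add_comm]
    | tmul a b => simp [tMap_ι, h.tMap_tAct]

/-- The map `tMap φ` respects the grading, the product and `Δ`, and it respects the action and the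
coaction up to `ψ`; all the defining conditions pull back along it. -/
theorem isHopfIdeal_comap (h : M.IsTwistedAut φ ψ) :
    M.IsHopfIdeal (M.nicholsIdeal.comap (tMap φ)) := by
  have hI := M.isHopfIdeal_nicholsIdeal
  let q : TensorAlgebra k V →ₐ[k] M.NicholsAlgebra := (NicholsAlgebra.mk M).comp (tMap φ)
  have hq : Function.Surjective q := (NicholsAlgebra.mk_surjective M).comp (tMap_surjective φ)
  have hker : LinearMap.ker q.toLinearMap =
      (M.nicholsIdeal.comap (tMap φ)).restrictScalars k :=
    Submodule.ext fun t => NicholsAlgebra.mk_eq_zero M (tMap φ t)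
  have hproj : ∀ n t, M.tProj n (tMap φ t) = tMap φ (M.tProj n t) :=
    M.tProj_algHom (tMap φ) φ (tMap_ι φ)
  refine ⟨inferInstance, fun n t ht => ?_, fun t ht n hn => ?_, fun γ t ht => ?_, fun t ht => ?_,
    fun t ht => ?_⟩
  · have h1 : M.tProj n (tMap φ t) ∈ M.nicholsIdeal := hI.isHomogeneous n ht
    rw [hproj] at h1
    exact h1
  · have h1 : M.tProj n (tMap φ t) = 0 := hI.proj_eq_zero _ ht n hn
    rw [hproj] at h1
    have h2 := congrArg (tMap φ.symm) h1
    rwa [tMap_symm_tMap, map_zero] at h2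
  · rw [Ideal.mem_comap, h.tMap_tAct]
    exact hI.act_mem _ _ ht
  · rw [mem_range_lTensor_iff (q := q.toLinearMap) hq hker]
    have h0 : (NicholsAlgebra.mk M).toLinearMap.lTensor (MonoidAlgebra k Γ)
        (M.tCoact (tMap φ t)) = 0 := by
      change NicholsAlgebra.coact M (NicholsAlgebra.mk M (tMap φ t)) = 0
      rw [(NicholsAlgebra.mk_eq_zero M _).2 ht, map_zero]
    rw [h.tCoact_tMap] at h0
    -- The coactions of `t` and of `tMap φ t` differ by `ψ` on the factor `kΓ`; being bijective, `ψ`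
    -- can be applied without affecting vanishing.
    apply (LinearEquiv.rTensor M.NicholsAlgebra
      (MonoidAlgebra.domCongr k k ψ).toLinearEquiv).injective
    rw [map_zero, ← h0]
    generalize M.tCoact t = z
    induction z using TensorProduct.induction_on with
    | zero => simp
    | add x y hx hy => simp only [map_add, hx, hy]
    | tmul a s => simp [q]
  · rw [mem_range_rTensor_sup_range_lTensor_iff (q := q.toLinearMap) hq hker]
    have h0 : TensorProduct.map (NicholsAlgebra.mk M).toLinearMap
        (NicholsAlgebra.mk M).toLinearMap (M.tComul (tMap φ t)) = 0 := by
      change NicholsAlgebra.comul M (NicholsAlgebra.mk M (tMap φ t)) = 0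
      rw [(NicholsAlgebra.mk_eq_zero M _).2 ht, map_zero]
    rw [h.tComul_tMap, ← LinearMap.comp_apply, ← TensorProduct.map_comp] at h0
    exact h0

/-- Maximality bounds preimages, so it is applied to the preimage under the inverse `φ.symm`. -/
theorem tMap_mem_nicholsIdeal (h : M.IsTwistedAut φ ψ) {t : TensorAlgebra k V}
    (ht : t ∈ M.nicholsIdeal) : tMap φ t ∈ M.nicholsIdeal := by
  refine h.symm.isHopfIdeal_comap.le ?_
  rwa [Ideal.mem_comap, tMap_symm_tMap]

/-- The algebra endomorphism of `𝔅(V)` that is induced by a twisted automorphism of `V`. -/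
def nicholsMap (h : M.IsTwistedAut φ ψ) : M.NicholsAlgebra →ₐ[k] M.NicholsAlgebra :=
  NicholsAlgebra.lift M ((NicholsAlgebra.mk M).comp (tMap φ)) fun _ ht =>
    (NicholsAlgebra.mk_eq_zero M _).2 (h.tMap_mem_nicholsIdeal ht)

theorem nicholsMap_mk (h : M.IsTwistedAut φ ψ) (t : TensorAlgebra k V) :
    h.nicholsMap (NicholsAlgebra.mk M t) = NicholsAlgebra.mk M (tMap φ t) :=
  rfl

theorem nicholsMap_ι (h : M.IsTwistedAut φ ψ) (v : V) :
    h.nicholsMap (NicholsAlgebra.ι M v) = NicholsAlgebra.ι M (φ v) :=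
  congrArg (NicholsAlgebra.mk M) (tMap_ι φ v)

theorem nicholsMap_smul (h : M.IsTwistedAut φ ψ) (γ : Γ) (r : M.NicholsAlgebra) :
    h.nicholsMap (γ • r) = ψ γ • h.nicholsMap r := by
  obtain ⟨t, rfl⟩ := NicholsAlgebra.mk_surjective M r
  rw [NicholsAlgebra.smul_mk, nicholsMap_mk, nicholsMap_mk, NicholsAlgebra.smul_mk, h.tMap_tAct]

/-- The algebra endomorphism of `𝔅(V) # kΓ` that is induced by a twisted automorphism of `V`. -/
def bosonizationMap (h : M.IsTwistedAut φ ψ) : M.Bosonization →ₐ[k] M.Bosonization :=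
  SkewMonoidAlgebra.liftNCAlgHom ((Bosonization.ofNichols M).comp h.nicholsMap)
    ((Bosonization.ofGroup M).comp ψ.toMonoidHom) fun {r γ} => by
      change Bosonization.ofNichols M (h.nicholsMap (γ • r)) * Bosonization.ofGroup M (ψ γ) =
        Bosonization.ofGroup M (ψ γ) * Bosonization.ofNichols M (h.nicholsMap r)
      rw [Bosonization.ofGroup_mul_ofNichols, h.nicholsMap_smul]

theorem bosonizationMap_single (h : M.IsTwistedAut φ ψ) (γ : Γ) (r : M.NicholsAlgebra) :
    h.bosonizationMap (SkewMonoidAlgebra.single γ r) =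
      Bosonization.ofNichols M (h.nicholsMap r) * Bosonization.ofGroup M (ψ γ) := by
  simp [bosonizationMap, SkewMonoidAlgebra.liftNCAlgHom, SkewMonoidAlgebra.liftNCRingHom]

theorem bosonizationMap_ofGroup (h : M.IsTwistedAut φ ψ) (γ : Γ) :
    h.bosonizationMap (Bosonization.ofGroup M γ) = Bosonization.ofGroup M (ψ γ) := by
  rw [Bosonization.ofGroup_apply, bosonizationMap_single, map_one, map_one, one_mul]

theorem bosonizationMap_ι (h : M.IsTwistedAut φ ψ) (v : V) :
    h.bosonizationMap (Bosonization.ofNichols M (NicholsAlgebra.ι M v)) =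
      Bosonization.ofNichols M (NicholsAlgebra.ι M (φ v)) := by
  rw [Bosonization.ofNichols_apply, bosonizationMap_single, map_one, map_one, mul_one,
    nicholsMap_ι]

theorem bosonizationMap_symm_comp (h : M.IsTwistedAut φ ψ) :
    h.symm.bosonizationMap.comp h.bosonizationMap = AlgHom.id k _ :=
  Bosonization.hom_ext M (fun γ => by simp [bosonizationMap_ofGroup])
    (fun g v _ => by simp [bosonizationMap_ι])

theorem bosonizationMap_comp_symm (h : M.IsTwistedAut φ ψ) :
    h.bosonizationMap.comp h.symm.bosonizationMap = AlgHom.id k _ :=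
  Bosonization.hom_ext M (fun γ => by simp [bosonizationMap_ofGroup])
    (fun g v _ => by simp [bosonizationMap_ι])

/-- The bialgebra automorphism of `𝔅(V) # kΓ` that is induced by a twisted automorphism of `V`. -/
def bosonizationEquiv (h : M.IsTwistedAut φ ψ) : M.Bosonization ≃ₐc[k] M.Bosonization :=
  BialgEquiv.ofAlgEquiv
    (AlgEquiv.ofAlgHom h.bosonizationMap h.symm.bosonizationMap h.bosonizationMap_comp_symm
      h.bosonizationMap_symm_comp)
    (Bosonization.hom_ext M
      (fun γ => by
        change Bosonization.counitHom M (h.bosonizationMap _) = Bosonization.counitHom M _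
        rw [bosonizationMap_ofGroup, Bosonization.counitHom_ofGroup,
          Bosonization.counitHom_ofGroup])
      (fun g v _ => by
        change Bosonization.counitHom M (h.bosonizationMap _) = Bosonization.counitHom M _
        rw [bosonizationMap_ι, Bosonization.counitHom_ι, Bosonization.counitHom_ι]))
    (Bosonization.hom_ext M
      (fun γ => by
        change Algebra.TensorProduct.map h.bosonizationMap h.bosonizationMap
          (Bosonization.comulHom M _) = Bosonization.comulHom M (h.bosonizationMap _)
        rw [bosonizationMap_ofGroup, Bosonization.comulHom_ofGroup, Bosonization.comulHom_ofGroup,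
          Algebra.TensorProduct.map_tmul, bosonizationMap_ofGroup])
      (fun g v hv => by
        change Algebra.TensorProduct.map h.bosonizationMap h.bosonizationMap
          (Bosonization.comulHom M _) = Bosonization.comulHom M (h.bosonizationMap _)
        rw [bosonizationMap_ι, Bosonization.comulHom_ι M hv,
          Bosonization.comulHom_ι M (h.coact_homogeneous hv), map_add,
          Algebra.TensorProduct.map_tmul, Algebra.TensorProduct.map_tmul, bosonizationMap_ofGroup,
          bosonizationMap_ι, map_one]))

end IsTwistedAut

/-! ### Diagonal Yetter-Drinfeld modules -/

section Diagonal

variable {M : YDModule k Γ V} {ι' : Type*} {x : Module.Basis ι' k V} {g : ι' → Γ}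
  {χ : ι' → Γ →* kˣ}

theorem isTwistedAut_of_basis
    (h_act : ∀ (γ : Γ) (j : ι'), M.act γ (x j) = (χ j γ : k) • x j)
    (h_coact : ∀ j : ι', M.coact (x j) = MonoidAlgebra.single (g j) 1 ⊗ₜ[k] x j)
    {φ : V ≃ₗ[k] V} {ψ : Γ ≃* Γ} {lam : ι' → kˣ} {σ : ι' → ι'}
    (hφ : ∀ i, φ (x i) = (lam i : k) • x (σ i)) (hg : ∀ i, ψ (g i) = g (σ i))
    (hχ : ∀ i, χ i = (χ (σ i)).comp ψ.toMonoidHom) : M.IsTwistedAut φ ψ where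
  map_act γ v := by
    refine LinearMap.congr_fun (f := φ.toLinearMap ∘ₗ M.act γ)
      (g := M.act (ψ γ) ∘ₗ φ.toLinearMap) (x.ext fun i => ?_) v
    have : χ i γ = χ (σ i) (ψ γ) := DFunLike.congr_fun (hχ i) γ
    simp [h_act, hφ, this, smul_smul, mul_comm]
  coact_map v := by
    refine LinearMap.congr_fun (f := M.coact ∘ₗ φ.toLinearMap)
      (g := (TensorProduct.congr (MonoidAlgebra.domCongr k k ψ).toLinearEquiv φ).toLinearMap ∘ₗ
        M.coact) (x.ext fun i => ?_) v
    simp [h_coact, hφ, hg]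

/-- Take the `x_j`-coordinate of `δ v` and of `γ.v`: it is multiplied by `g_j` and `χ_j γ` by
diagonality, and by `g'` and `χ' γ` by hypothesis. -/
theorem eq_of_coord_ne_zero
    (h_act : ∀ (γ : Γ) (j : ι'), M.act γ (x j) = (χ j γ : k) • x j)
    (h_coact : ∀ j : ι', M.coact (x j) = MonoidAlgebra.single (g j) 1 ⊗ₜ[k] x j)
    {v : V} {g' : Γ} {χ' : Γ →* kˣ} (hv : M.coact v = MonoidAlgebra.single g' 1 ⊗ₜ v)
    (hv' : ∀ γ, M.act γ v = (χ' γ : k) • v) {j : ι'} (hj : x.coord j v ≠ 0) :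
    g j = g' ∧ χ j = χ' := by
  classical
  constructor
  · have h : TensorProduct.rid k _ ((x.coord j).lTensor _ (M.coact v)) =
        x.coord j v • MonoidAlgebra.single (g j) (1 : k) := by
      refine LinearMap.congr_fun
        (f := (TensorProduct.rid k _).toLinearMap ∘ₗ (x.coord j).lTensor _ ∘ₗ M.coact)
        (g := (x.coord j).smulRight (MonoidAlgebra.single (g j) (1 : k))) (x.ext fun i => ?_) v
      by_cases hij : i = j
      · subst hij
        simp [h_coact]
      · simp [h_coact, hij]
    rw [hv, LinearMap.lTensor_tmul, TensorProduct.rid_tmul] at h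
    have h' := congrArg (fun a => a.coeff g') h
    by_contra hne
    simp [MonoidAlgebra.coeff_single, hne] at h'
    exact hj h'
  · ext γ
    have h : x.coord j (M.act γ v) = χ j γ * x.coord j v := by
      refine LinearMap.congr_fun (f := x.coord j ∘ₗ M.act γ) (g := (χ j γ : k) • x.coord j)
        (x.ext fun i => ?_) v
      by_cases hij : i = j
      · subst hij
        simp [h_act]
      · simp [h_act, hij]
    rw [hv', map_smul, smul_eq_mul] at h
    exact (mul_right_cancel₀ hj h).symm

/-- Any two basis vectors occurring in `v` share the pair `(g', χ')`, so distinctness of the pairs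
leaves only one. -/
theorem exists_eq_smul_basis
    (h_act : ∀ (γ : Γ) (j : ι'), M.act γ (x j) = (χ j γ : k) • x j)
    (h_coact : ∀ j : ι', M.coact (x j) = MonoidAlgebra.single (g j) 1 ⊗ₜ[k] x j)
    (h_distinct : ∀ i j, i ≠ j → (g i, χ i) ≠ (g j, χ j))
    {v : V} {g' : Γ} {χ' : Γ →* kˣ} (hv : M.coact v = MonoidAlgebra.single g' 1 ⊗ₜ v)
    (hv' : ∀ γ, M.act γ v = (χ' γ : k) • v) (hv0 : v ≠ 0) :
    ∃ (j : ι') (c : kˣ), v = (c : k) • x j ∧ g j = g' ∧ χ j = χ' := by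
  classical
  obtain ⟨j, hj⟩ : ∃ j, x.coord j v ≠ 0 := by
    by_contra! h
    exact hv0 (x.forall_coord_eq_zero_iff.1 h)
  have hj' := eq_of_coord_ne_zero h_act h_coact hv hv' hj
  refine ⟨j, Units.mk0 _ hj, x.ext_elem fun i => ?_, hj'⟩
  by_cases hij : i = j
  · subst hij
    simp
  · have : x.coord i v = 0 := by
      by_contra hi
      have hi' := eq_of_coord_ne_zero h_act h_coact hv hv' hi
      exact h_distinct i j hij (by rw [hi'.1, hi'.2, hj'.1, hj'.2])
    rw [x.coord_apply] at this
    simp [this, Ne.symm hij]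

end Diagonal

/-! ### Automorphisms of the bosonization -/

namespace Bosonization

variable {M : YDModule k Γ V}

theorem ofNichols_injective : Function.Injective (ofNichols M) :=
  SkewMonoidAlgebra.single_injective 1

/-- Bialgebra automorphisms of the bosonization restrict to automorphisms of `Γ`. -/
theorem exists_map_ofGroup (Φ : M.Bosonization ≃ₐc[k] M.Bosonization) :
    ∃ ψ : Γ ≃* Γ, ∀ γ, Φ (ofGroup M γ) = ofGroup M (ψ γ) := by
  choose f hf using fun γ => exists_eq_ofGroup M ((isGroupLikeElem_ofGroup M γ).map Φ)
  choose f' hf' using fun γ => exists_eq_ofGroup M ((isGroupLikeElem_ofGroup M γ).map Φ.symm)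
  refine ⟨⟨⟨f, f', fun γ => ?_, fun γ => ?_⟩, fun γ γ' => ?_⟩, hf⟩
  · apply ofGroup_injective M
    rw [← hf', ← hf, BialgEquiv.symm_apply_apply]
  · apply ofGroup_injective M
    rw [← hf, ← hf', BialgEquiv.apply_symm_apply]
  · apply ofGroup_injective M
    change ofGroup M (f (γ * γ')) = ofGroup M (f γ * f γ')
    rw [← hf, map_mul, map_mul, hf, hf, map_mul]

theorem bialgEquiv_ext {Φ Φ' : M.Bosonization ≃ₐc[k] M.Bosonization}
    (hΓ : ∀ γ, Φ (ofGroup M γ) = Φ' (ofGroup M γ))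
    (hV : ∀ v, Φ (ofNichols M (NicholsAlgebra.ι M v)) = Φ' (ofNichols M (NicholsAlgebra.ι M v))) :
    Φ = Φ' := by
  have h : (Φ : M.Bosonization ≃ₐ[k] M.Bosonization).toAlgHom =
      (Φ' : M.Bosonization ≃ₐ[k] M.Bosonization).toAlgHom :=
    hom_ext M hΓ (fun _ v _ => hV v)
  exact BialgEquiv.ext fun a => DFunLike.congr_fun h a

/-- Bialgebra automorphisms of the bosonization map the eigenvectors in `V` with nontrivial
character to eigenvectors in `V`. -/
theorem exists_map_ι (Φ : M.Bosonization ≃ₐc[k] M.Bosonization) {ψ : Γ ≃* Γ}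
    (hψ : ∀ γ, Φ (ofGroup M γ) = ofGroup M (ψ γ)) {w : V} {g : Γ} {χ : Γ →* kˣ} (hχ : χ ≠ 1)
    (hw : M.coact w = MonoidAlgebra.single g 1 ⊗ₜ w) (hw' : ∀ γ, M.act γ w = (χ γ : k) • w) :
    ∃ v : V, Φ (ofNichols M (NicholsAlgebra.ι M w)) = ofNichols M (NicholsAlgebra.ι M v) ∧
      M.coact v = MonoidAlgebra.single (ψ g) 1 ⊗ₜ v ∧
        ∀ γ, M.act γ v = (χ.comp ψ.symm.toMonoidHom γ : k) • v := by
  -- The image is skew primitive for `ψ g`, and `Γ` acts on it by `χ ∘ ψ⁻¹`, which is nontrivial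
  -- because `χ` is.
  refine exists_eq_ι_of_skewPrimitive M (fun h => hχ (MonoidHom.ext fun γ => ?_)) ?_ fun γ => ?_
  · simpa using DFunLike.congr_fun h (ψ γ)
  · rw [← CoalgHomClass.map_comp_comul_apply]
    have : Coalgebra.comul (R := k) (ofNichols M (NicholsAlgebra.ι M w)) = _ := comulHom_ι M hw
    rw [this, map_add, TensorProduct.map_tmul, TensorProduct.map_tmul]
    simp [hψ]
  · obtain ⟨δ, rfl⟩ := ψ.surjective γ
    rw [← hψ, ← map_mul, ← map_mul, ofGroup_mul_ofNichols, NicholsAlgebra.smul_ι, hw', map_smul,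
      map_smul, smul_mul_assoc, map_smul]
    simp

variable {n : ℕ} {x : Module.Basis (Fin n) k V} {g : Fin n → Γ} {χ : Fin n → Γ →* kˣ}

theorem exists_pair_of_bialgEquiv
    (h_act : ∀ (γ : Γ) (j : Fin n), M.act γ (x j) = (χ j γ : k) • x j)
    (h_coact : ∀ j : Fin n, M.coact (x j) = MonoidAlgebra.single (g j) 1 ⊗ₜ[k] x j)
    (h_ne : ∀ i, χ i ≠ 1) (h_distinct : ∀ i j, i ≠ j → (g i, χ i) ≠ (g j, χ j))
    (Φ : M.Bosonization ≃ₐc[k] M.Bosonization) :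
    ∃ p : {p : (V ≃ₗ[k] V) × (Γ ≃* Γ) //
          ∃ (lam : Fin n → kˣ) (σ : Equiv.Perm (Fin n)),
            (∀ i, p.1 (x i) = (lam i : k) • x (σ i)) ∧
            (∀ i, p.2 (g i) = g (σ i)) ∧
            (∀ i, χ i = (χ (σ i)).comp p.2.toMonoidHom)},
      (∀ v, Φ (ofNichols M (NicholsAlgebra.ι M v)) =
        ofNichols M (NicholsAlgebra.ι M (p.1.1 v))) ∧
      ∀ γ, Φ (ofGroup M γ) = ofGroup M (p.1.2 γ) := by
  obtain ⟨ψ, hψ⟩ := exists_map_ofGroup Φ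
  have key : ∀ i, ∃ (j : Fin n) (c : kˣ),
      Φ (ofNichols M (NicholsAlgebra.ι M (x i))) =
        ofNichols M (NicholsAlgebra.ι M ((c : k) • x j)) ∧
      g j = ψ (g i) ∧ χ j = (χ i).comp ψ.symm.toMonoidHom := by
    intro i
    obtain ⟨v, hv, hvc, hva⟩ := exists_map_ι Φ hψ (h_ne i) (h_coact i) (fun γ => h_act γ i)
    have hv0 : v ≠ 0 := by
      rintro rfl
      rw [map_zero, map_zero, map_eq_zero_iff Φ (EquivLike.injective Φ),
        map_eq_zero_iff _ ofNichols_injective,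
        map_eq_zero_iff _ (NicholsAlgebra.ι_injective M)] at hv
      exact x.ne_zero i hv
    obtain ⟨j, c, rfl, hj⟩ := exists_eq_smul_basis h_act h_coact h_distinct hvc hva hv0
    exact ⟨j, c, hv, hj⟩
  choose s c hs hg hχ using key
  -- If `s i = s j`, then `(g i, χ i)` and `(g j, χ j)` agree after the twist by `ψ`, hence agree.
  -- Finiteness makes `s` a permutation.
  have hinj : Function.Injective s := by
    intro i j hij
    by_contra h
    refine h_distinct i j h (Prod.ext (ψ.injective ?_) (MonoidHom.ext fun γ => ?_))
    · rw [← hg, ← hg, hij]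
    · have h1 : (χ i).comp ψ.symm.toMonoidHom = (χ j).comp ψ.symm.toMonoidHom := by
        rw [← hχ, ← hχ, hij]
      simpa using DFunLike.congr_fun h1 (ψ γ)
  let σ : Equiv.Perm (Fin n) := Equiv.ofBijective s (Finite.injective_iff_bijective.1 hinj)
  -- Reindexing a basis along `e` evaluates it at `e.symm`, so `σ.symm` is what produces `x (σ i)`.
  let φ : V ≃ₗ[k] V := x.equiv ((x.reindex σ.symm).unitsSMul c) (Equiv.refl _)
  have hφ : ∀ i, φ (x i) = (c i : k) • x (σ i) := by
    intro i
    simp only [φ, Module.Basis.equiv_apply, Module.Basis.unitsSMul_apply,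
      Module.Basis.reindex_apply, Equiv.symm_symm, Equiv.refl_apply]
    rfl
  refine ⟨⟨(φ, ψ), c, σ, hφ, fun i => (hg i).symm, fun i => ?_⟩, fun v => ?_, hψ⟩
  · change χ i = (χ (s i)).comp ψ.toMonoidHom
    rw [hχ]
    ext γ
    simp
  · refine LinearMap.congr_fun
      (f := (Φ : M.Bosonization ≃ₐ[k] M.Bosonization).toLinearMap ∘ₗ
        (ofNichols M).toLinearMap ∘ₗ NicholsAlgebra.ι M)
      (g := (ofNichols M).toLinearMap ∘ₗ NicholsAlgebra.ι M ∘ₗ φ.toLinearMap)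
      (x.ext fun i => ?_) v
    change Φ (ofNichols M (NicholsAlgebra.ι M (x i))) =
      ofNichols M (NicholsAlgebra.ι M (φ (x i)))
    rw [hs, hφ]
    rfl

end Bosonization

end

end YDModule

theorem theorem1p2 {k Γ V : Type*} [Field k] [CommGroup Γ] [AddCommGroup V] [Module k V]
    (M : YDModule k Γ V) (n : ℕ) (x : Module.Basis (Fin n) k V)
    (g : Fin n → Γ) (χ : Fin n → Γ →* kˣ)
    (h_act : ∀ (γ : Γ) (j : Fin n), M.act γ (x j) = (χ j γ : k) • x j)
    (h_coact : ∀ j : Fin n, M.coact (x j) = MonoidAlgebra.single (g j) 1 ⊗ₜ[k] x j)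
    (h_ne : ∀ i, χ i ≠ 1)
    (h_distinct : ∀ i j, i ≠ j → (g i, χ i) ≠ (g j, χ j)) :
    ∃ e : (M.Bosonization ≃ₐc[k] M.Bosonization) ≃
        {p : (V ≃ₗ[k] V) × (Γ ≃* Γ) //
          ∃ (lam : Fin n → kˣ) (σ : Equiv.Perm (Fin n)),
            (∀ i, p.1 (x i) = (lam i : k) • x (σ i)) ∧
            (∀ i, p.2 (g i) = g (σ i)) ∧
            (∀ i, χ i = (χ (σ i)).comp p.2.toMonoidHom)},
      ∀ Φ : M.Bosonization ≃ₐc[k] M.Bosonization,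
        (∀ v : V,
          Φ (SkewMonoidAlgebra.single 1 (YDModule.NicholsAlgebra.ι M v)) =
            SkewMonoidAlgebra.single 1 (YDModule.NicholsAlgebra.ι M ((e Φ).1.1 v))) ∧
        (∀ γ : Γ,
          Φ (SkewMonoidAlgebra.single γ 1) = SkewMonoidAlgebra.single ((e Φ).1.2 γ) 1) := by
  choose e heV heΓ using
    YDModule.Bosonization.exists_pair_of_bialgEquiv h_act h_coact h_ne h_distinct
  -- Injectivity holds because `Γ` and `V` generate the bosonization. For surjectivity, the pair
  -- chosen for `bosonizationEquiv` must be the given one, since its values on `V` and `Γ` determine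
  -- it through the injections of `V` and `Γ` into the bosonization.
  refine ⟨Equiv.ofBijective e ⟨fun Φ Φ' h => ?_, fun p => ?_⟩, fun Φ => ⟨heV Φ, heΓ Φ⟩⟩
  · exact YDModule.Bosonization.bialgEquiv_ext (fun γ => by rw [heΓ, heΓ, h])
      (fun v => by rw [heV, heV, h])
  · obtain ⟨⟨φ, ψ⟩, lam, σ, hφ, hg, hχ⟩ := p
    have h := YDModule.isTwistedAut_of_basis h_act h_coact hφ hg hχ
    refine ⟨h.bosonizationEquiv, Subtype.ext (Prod.ext (LinearEquiv.ext fun v => ?_)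
      (MulEquiv.ext fun γ => ?_))⟩
    · exact YDModule.NicholsAlgebra.ι_injective M (YDModule.Bosonization.ofNichols_injective
        ((heV _ v).symm.trans (h.bosonizationMap_ι v)))
    · exact YDModule.Bosonization.ofGroup_injective M
        ((heΓ _ γ).symm.trans (h.bosonizationMap_ofGroup γ))
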